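/- **Setting.** Let $v:(0,\infty)\to\mathbb R\cup\{+\infty\}$ be a pair potential with a hard core of radius $r_{\rm hc}>0$: $v=+\infty$ on $(0,r_{\rm hc}]$ and $v$ is real-valued and $C^2$ on $(r_{\rm hc},\infty)$. Assume that there are $r_{\rm hc}<z_{\min}<z_{\max}<2z_{\min}$, $\alpha_1,\alpha_2>0$ and $s>2$ such that (i) $z_{\max}$ is the unique minimizer of $v$, $v(z_{\max})<0$, $v$ is decreasing on $(0,z_{\max})$, and increasing and non-positive on $(z_{\max},\infty)$ (monotonicity in the weak sense); (ii) $v(z)\ge-\alpha_1z^{-s}$ for all $z>0$, and $v(z)+v(z_{\max})-2\alpha_1\sum_{n\ge2}(nz)^{-s}>0$ for all $0<z<z_{\min}$; (iii) $v''$ is decreasing on $[z_{\min},z_{\max}]$, and increasing and non-positive on $[2z_{\min},\infty)$; (iv) $v''(z)\ge-\alpha_2z^{-s-2}$ for all $z>r_{\rm hc}$, and $v''(z_{\max})+\sum_{n\ge2}n^2v''(nz_{\min})>0$. Let $m\in\{1,2,\dots\}\cup\{\infty\}$. For $\beta,p>0$ and $N\ge 1$, let $\mathbb Q_N^{(\beta)}$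 be the probability measure on $\mathbb R_+^{N-1}$, $\mathbb R_+=(0,\infty)$, with density proportional to $e^{-\beta\mathcal E_N}$, where $$\mathcal E_N(z_1,\dots,z_{N-1})=\sum_{1\le i<j\le N,\ j-i\le m}v(z_i+\cdots+z_{j-1})+p\sum_{j=1}^{N-1}z_j .$$ The bulk Gibbs measure $\mu_\beta$ (which also depends on $p$ and $m$) is the shift-invariant probability measure on $\mathbb R_+^{\mathbb Z}$ such that, for all $k\in\mathbb N$, all bounded continuous $f$ of $k$ variables and all integer sequences $i_N$ with $i_N\to\infty$ and $N-i_N\to\infty$, $$\lim_{N\to\infty}\int f(z_{i_N+1},\dots,z_{i_N+k})\,d\mathbb Q_N^{(\beta)}=\int f(z_1,\dots,z_k)\,d\mu_\beta .$$ For $f:\mathbb R_+^k\to\mathbb R$ write $f_i((z_j)_{j\in\mathbb Z})=f(z_i,\dots,z_{i+k-1})$ and $\|f\|_\infty=\sup_{\mathbb R_+^k}|f|$. **Theorem.** There exist $c,C>0$, depending on $v$ and $m$ but not on $\beta$ and $p$, such that for all $\beta,p>0$ the measure $\mu_\beta$ exists and is unique, and for all integers $k\ge1$, all bounded measurable $f,g:\mathbb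 R_+^k\to\mathbb R$ and all integers $n\ge k$, $$\bigl|\mu_\beta(f_0g_n)-\mu_\beta(f_0)\mu_\beta(g_n)\bigr|\le\min_{q\in\mathbb N:\,1\le q\le n/k}\Bigl((1-e^{-c\beta})^q+e^{c\beta}\bigl(e^{C\beta(q/n)^{s-2}}-1\bigr)\Bigr)\|f\|_\infty\|g\|_\infty .$$ If $m$ is finite, $m\ge2$ and $k=m-1$, then moreover, with the same $c$ and for all integers $n\ge0$, $$\bigl|\mu_\beta(f_0g_n)-\mu_\beta(f_0)\mu_\beta(g_n)\bigr|\le(1-e^{-c\beta})^{\lfloor n/k\rfloor}\,\|f\|_\infty\|g\|_\infty .$$ -/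

import Mathlib

open MeasureTheory Filter Topology Set

noncomputable section

namespace LJChain

/-- The real-valued version of the pair potential; it is only used where `v` is finite,
i.e. on `(r_hc, ∞)`. -/
def realPart (v : ℝ → EReal) (r : ℝ) : ℝ := (v r).toReal

/-- The standing assumption on the pair potential `v : (0, ∞) → ℝ ∪ {+∞}` (values of `v` at
non-positive arguments play no role): a hard core of radius `rhc`, and a Lennard-Jones type
shape with decay exponent `s > 2`. Sums over `n ≥ 2` are written with the index `n + 2`. -/
structure IsLennardJonesType (v : ℝ → EReal) (rhc zmin zmax α₁ α₂ s : ℝ) : Prop where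
  rhc_nonneg : 0 ≤ rhc
  eq_top : ∀ r, 0 < r → r ≤ rhc → v r = ⊤
  ne_top : ∀ r, rhc < r → v r ≠ ⊤
  ne_bot : ∀ r, rhc < r → v r ≠ ⊥
  contDiffOn : ContDiffOn ℝ 2 (realPart v) (Ioi rhc)
  rhc_lt_zmin : rhc < zmin
  zmin_lt_zmax : zmin < zmax
  zmax_lt : zmax < 2 * zmin
  α₁_pos : 0 < α₁
  α₂_pos : 0 < α₂
  two_lt_s : 2 < s
  unique_min : ∀ r, 0 < r → r ≠ zmax → v zmax < v r
  min_neg : v zmax < 0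
  antitoneOn : AntitoneOn v (Ioo 0 zmax)
  monotoneOn : MonotoneOn v (Ioi zmax)
  nonpos : ∀ r, zmax < r → v r ≤ 0
  lower_bound : ∀ z, 0 < z → ((-α₁ * z ^ (-s) : ℝ) : EReal) ≤ v z
  repulsion : ∀ z, 0 < z → z < zmin →
    0 < v z + v zmax - ((2 * α₁ * ∑' n : ℕ, (((n : ℝ) + 2) * z) ^ (-s) : ℝ) : EReal)
  deriv2_antitoneOn : AntitoneOn (deriv^[2] (realPart v)) (Icc zmin zmax)
  deriv2_monotoneOn : MonotoneOn (deriv^[2] (realPart v)) (Ici (2 * zmin))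
  deriv2_nonpos : ∀ z, 2 * zmin ≤ z → deriv^[2] (realPart v) z ≤ 0
  deriv2_lower_bound : ∀ z, rhc < z → -α₂ * z ^ (-s - 2) ≤ deriv^[2] (realPart v) z
  deriv2_convexity : 0 < deriv^[2] (realPart v) zmax +
    ∑' n : ℕ, ((n : ℝ) + 2) ^ 2 * deriv^[2] (realPart v) (((n : ℝ) + 2) * zmin)

/-- The Gibbs energy at pressure `p` of a chain with `M` spacings (that is `M + 1` particles).
A pair of particles corresponds to the nonempty interval `{i, …, j}` of the spacings between
them, and the pair interacts if this interval has at most `m` elements. -/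
def energy (v : ℝ → EReal) (m : ℕ∞) (p : ℝ) {M : ℕ} (z : Fin M → ℝ) : EReal :=
  (∑ i : Fin M, ∑ j ∈ Finset.Ici i,
    if ((Finset.Icc i j).card : ℕ∞) ≤ m then v (∑ l ∈ Finset.Icc i j, z l) else 0)
  + ((p * ∑ i : Fin M, z i : ℝ) : EReal)

/-- The positive orthant `ℝ₊ᵏ`. -/
def posOrthant (k : ℕ) : Set (Fin k → ℝ) := {x | ∀ i, 0 < x i}

/-- The unnormalised Gibbs measure `exp (-β E) dz` on the positive orthant. -/
def gibbsWeight (v : ℝ → EReal) (m : ℕ∞) (p β : ℝ) (M : ℕ) : Measure (Fin M → ℝ) :=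
  (volume.restrict (posOrthant M)).withDensity
    fun z => EReal.exp (-((β : EReal) * energy v m p z))

/-- The finite-volume Gibbs measure of the chain with `M` spacings; the total mass of
`gibbsWeight` is the partition function. -/
def finiteGibbs (v : ℝ → EReal) (m : ℕ∞) (p β : ℝ) (M : ℕ) : Measure (Fin M → ℝ) :=
  (gibbsWeight v m p β M univ)⁻¹ • gibbsWeight v m p β M

/-- The `k` consecutive spacings of a finite chain that start at the index `i` (counted from
`0`); entries outside the chain are set to `0`. -/
def finWindow {M : ℕ} (k i : ℕ) (z : Fin M → ℝ) : Fin k → ℝ :=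
  fun l => if h : i + (l : ℕ) < M then z ⟨i + l, h⟩ else 0

/-- The `k` consecutive spacings `(z_i, …, z_{i+k-1})` of a bi-infinite chain. -/
def window (k : ℕ) (i : ℤ) (z : ℤ → ℝ) : Fin k → ℝ := fun l => z (i + (l : ℤ))

/-- `μ` is the bulk Gibbs measure on `ℝ₊^ℤ`: the thermodynamic limit of the finite-volume Gibbs
measures seen around sites `i_M` whose distance to both ends of the chain tends to infinity.
The limit is the same for every position `a` of the window in the bi-infinite chain, so the
shift-invariance of `μ` is included. -/
structure IsBulkGibbsMeasure (v : ℝ → EReal) (m : ℕ∞) (p β : ℝ) (μ : Measure (ℤ → ℝ)) :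
    Prop where
  isProbabilityMeasure : IsProbabilityMeasure μ
  ae_pos : ∀ᵐ z ∂μ, ∀ j, 0 < z j
  tendsto : ∀ (k : ℕ) (f : BoundedContinuousFunction (Fin k → ℝ) ℝ) (a : ℤ) (i : ℕ → ℕ),
    Tendsto i atTop atTop → Tendsto (fun M : ℕ => (M : ℤ) - (i M : ℤ)) atTop atTop →
    Tendsto (fun M : ℕ => ∫ z, f (finWindow k (i M) z) ∂(finiteGibbs v m p β M)) atTop
      (𝓝 (∫ z, f (window k a z) ∂μ))

/-- `f : ℝ₊ᵏ → ℝ` is bounded. -/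
def IsBoundedFun {k : ℕ} (f : (Fin k → ℝ) → ℝ) : Prop :=
  BddAbove (range fun x : posOrthant k => |f x|)

/-- The supremum norm of a function on `ℝ₊ᵏ`. -/
def supNorm {k : ℕ} (f : (Fin k → ℝ) → ℝ) : ℝ := ⨆ x : posOrthant k, |f x|

/-- The covariance `μ(f_0 g_n) - μ(f_0) μ(g_n)`, with `f_i(z) = f(z_i, …, z_{i+k-1})`. -/
def correlation (μ : Measure (ℤ → ℝ)) {k : ℕ} (f g : (Fin k → ℝ) → ℝ) (n : ℕ) : ℝ :=
  (∫ z, f (window k 0 z) * g (window k n z) ∂μ)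
    - (∫ z, f (window k 0 z) ∂μ) * ∫ z, g (window k n z) ∂μ

end LJChain

end

/-! The hard core forces `n` consecutive spacings to have total length above `n * rhc`, so an
interaction through `n ≥ 2` spacings is at most `b * n ^ (-s)` in absolute value
(`exists_abs_realPart_le`). The pressure and the nearest-neighbour term are absorbed into the law of
a single spacing (`siteMeasure`). The chain becomes a product measure tilted by a bounded
Hamiltonian (`finiteGibbs_eq_tilted`), and `p` drops out of all estimates. Since `s > 2`, the
interaction across a cut is at most `K = O(β)`, and across a block of `L` spacings at most `κ = O(β
L^(2-s))`, uniformly in the volume and the configuration (`crossBound`, `farBound`).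

Fix the spacings right of a cut. Two boundary conditions give potentials on the left that agree up
to a constant and an error `2K`, so the conditional laws overlap by at least `exp (-4K)` and
oscillations contract by `1 - exp (-4K)` (`abs_integral_tilted_sub_le`). If the boundary conditions
agree on the next `L` spacings, the error is only `2κ`. Conditioning block after block gives the
recursion `oscRate` (`abs_condE_sub_le`, `oscRate_le`). A covariance is then bounded by conditioning
the left function on everything to the right (`abs_cov_tilted_ham_le`).

The loss of memory also compares different volumes, so local expectations are Cauchy; with tightness
this yields the bulk measure (`exists_bulk`), and the covariance bound passes to the limit. The
general rate comes from blocks of length `⌊n/q⌋`; for finite `m`, blocks of length `m - 1` make `κ =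
0`. -/

noncomputable section

namespace LJChain

/-! ### Bounded measurable functions. -/

/-- Bounded measurable real functions. -/
structure BddMeas {Ω : Type*} [MeasurableSpace Ω] (f : Ω → ℝ) : Prop where
  measurable : Measurable f
  bdd : ∃ M : ℝ, ∀ ω, |f ω| ≤ M

namespace BddMeas

variable {Ω Ω' : Type*} [MeasurableSpace Ω] [MeasurableSpace Ω'] {f g : Ω → ℝ}

lemma comp (hf : BddMeas f) {T : Ω' → Ω} (hT : Measurable T) : BddMeas (fun x => f (T x)) := by
  obtain ⟨M, hM⟩ := hf.bdd
  exact ⟨hf.measurable.comp hT, M, fun x => hM _⟩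

lemma const (c : ℝ) : BddMeas (fun _ : Ω => c) := ⟨measurable_const, |c|, fun _ => le_rfl⟩

lemma mul (hf : BddMeas f) (hg : BddMeas g) : BddMeas (fun x => f x * g x) := by
  obtain ⟨M, hM⟩ := hf.bdd
  obtain ⟨N, hN⟩ := hg.bdd
  refine ⟨hf.measurable.mul hg.measurable, M * N, fun x => ?_⟩
  rw [abs_mul]
  exact mul_le_mul (hM x) (hN x) (abs_nonneg _) ((abs_nonneg _).trans (hM x))

lemma add (hf : BddMeas f) (hg : BddMeas g) : BddMeas (fun x => f x + g x) := by
  obtain ⟨M, hM⟩ := hf.bdd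
  obtain ⟨N, hN⟩ := hg.bdd
  exact ⟨hf.measurable.add hg.measurable, M + N,
    fun x => (abs_add_le _ _).trans (add_le_add (hM x) (hN x))⟩

lemma sub (hf : BddMeas f) (hg : BddMeas g) : BddMeas (fun x => f x - g x) := by
  obtain ⟨M, hM⟩ := hf.bdd
  obtain ⟨N, hN⟩ := hg.bdd
  exact ⟨hf.measurable.sub hg.measurable, M + N,
    fun x => (abs_sub _ _).trans (add_le_add (hM x) (hN x))⟩

lemma sum {ι : Type*} (s : Finset ι) {F : ι → Ω → ℝ} (hF : ∀ i ∈ s, BddMeas (F i)) :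
    BddMeas (fun x => ∑ i ∈ s, F i x) := by
  classical
  induction s using Finset.induction_on with
  | empty => simpa using const 0
  | insert a s ha ih =>
    simp only [Finset.sum_insert ha]
    exact (hF a (by simp)).add (ih fun i hi => hF i (by simp [hi]))

lemma exp (hf : BddMeas f) : BddMeas (fun x => Real.exp (f x)) := by
  obtain ⟨M, hM⟩ := hf.bdd
  refine ⟨hf.measurable.exp, Real.exp M, fun x => ?_⟩
  rw [Real.abs_exp]
  exact Real.exp_le_exp.2 ((le_abs_self _).trans (hM x))

lemma indicator {s : Set Ω} (hs : MeasurableSet s) : BddMeas (s.indicator (fun _ => (1 : ℝ))) := by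
  refine ⟨measurable_const.indicator hs, 1, fun x => ?_⟩
  by_cases hx : x ∈ s <;> simp [hx]

lemma integrable (hf : BddMeas f) (μ : Measure Ω) [IsFiniteMeasure μ] : Integrable f μ := by
  obtain ⟨M, hM⟩ := hf.bdd
  exact Integrable.of_bound hf.measurable.aestronglyMeasurable M
    (Eventually.of_forall fun x => by simpa using hM x)

lemma integral_right {F : Ω × Ω' → ℝ} (hF : BddMeas F) (μ : Measure Ω')
    [IsProbabilityMeasure μ] : BddMeas (fun x => ∫ y, F (x, y) ∂μ) := by
  obtain ⟨M, hM⟩ := hF.bdd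
  refine ⟨(hF.measurable.stronglyMeasurable.integral_prod_right').measurable, M, fun x => ?_⟩
  have := norm_integral_le_of_norm_le_const (μ := μ) (f := fun y => F (x, y)) (C := M)
    (Eventually.of_forall fun y => by simpa using hM _)
  simpa using this

end BddMeas

/-! ### Exponential tilts, the Doeblin estimate and covariances. -/

section Tilted

variable {Ω : Type*} [MeasurableSpace Ω] (P : Measure Ω)

lemma integral_tilted_eq_div (U h : Ω → ℝ) :
    ∫ x, h x ∂(P.tilted U) = (∫ x, Real.exp (U x) * h x ∂P) / ∫ x, Real.exp (U x) ∂P := by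
  rw [integral_tilted, ← integral_div]
  congr 1 with x
  simp only [smul_eq_mul]
  ring

variable [IsProbabilityMeasure P]

lemma isProbabilityMeasure_tilted_of_bddMeas {U : Ω → ℝ} (hU : BddMeas U) :
    IsProbabilityMeasure (P.tilted U) :=
  isProbabilityMeasure_tilted (hU.exp.integrable P)

lemma integral_exp_pos_of_bddMeas {U : Ω → ℝ} (hU : BddMeas U) :
    0 < ∫ x, Real.exp (U x) ∂P := integral_exp_pos (hU.exp.integrable P)

/-- Potentials that agree up to a constant and an error `a` have mutual densities at least
`exp (-2a)`. -/
lemma exp_mul_integral_tilted_le {U U' h : Ω → ℝ} (hU : BddMeas U) (hU' : BddMeas U')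
    (hh : BddMeas h) (hh0 : ∀ x, 0 ≤ h x) {a c : ℝ} (hd : ∀ x, |U x - U' x - c| ≤ a) :
    Real.exp (-(2 * a)) * ∫ x, h x ∂(P.tilted U') ≤ ∫ x, h x ∂(P.tilted U) := by
  rw [integral_tilted_eq_div, integral_tilted_eq_div]
  have hZ := integral_exp_pos_of_bddMeas P hU
  have hZ' := integral_exp_pos_of_bddMeas P hU'
  have h1 : Real.exp (c - a) * ∫ x, Real.exp (U' x) * h x ∂P ≤ ∫ x, Real.exp (U x) * h x ∂P := by
    rw [← integral_const_mul]
    refine integral_mono (((hU'.exp.mul hh).integrable P).const_mul _)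
      ((hU.exp.mul hh).integrable P) fun x => ?_
    dsimp only
    rw [← mul_assoc, ← Real.exp_add]
    refine mul_le_mul_of_nonneg_right (Real.exp_le_exp.2 ?_) (hh0 x)
    have := abs_le.1 (hd x)
    linarith
  have h2 : ∫ x, Real.exp (U x) ∂P ≤ Real.exp (c + a) * ∫ x, Real.exp (U' x) ∂P := by
    rw [← integral_const_mul]
    refine integral_mono (hU.exp.integrable P) ((hU'.exp.integrable P).const_mul _) fun x => ?_
    dsimp only
    rw [← Real.exp_add]
    refine Real.exp_le_exp.2 ?_
    have := abs_le.1 (hd x)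
    linarith
  have h3 : 0 ≤ ∫ x, Real.exp (U' x) * h x ∂P :=
    integral_nonneg fun x => mul_nonneg (Real.exp_pos _).le (hh0 x)
  rw [← mul_div_assoc, div_le_div_iff₀ hZ' hZ]
  calc Real.exp (-(2 * a)) * (∫ x, Real.exp (U' x) * h x ∂P) * ∫ x, Real.exp (U x) ∂P
      ≤ Real.exp (-(2 * a)) * (∫ x, Real.exp (U' x) * h x ∂P)
        * (Real.exp (c + a) * ∫ x, Real.exp (U' x) ∂P) := by gcongr
    _ = (Real.exp (-(2 * a)) * Real.exp (c + a)) * (∫ x, Real.exp (U' x) * h x ∂P)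
        * ∫ x, Real.exp (U' x) ∂P := by ring
    _ = Real.exp (c - a) * (∫ x, Real.exp (U' x) * h x ∂P) * ∫ x, Real.exp (U' x) ∂P := by
      rw [← Real.exp_add]; congr 3; ring
    _ ≤ _ := by gcongr

/-- Subtracting its infimum makes `h` take values in `[0, D]`; by the minorisation, passing from one
tilt to the other keeps a fraction `exp (-2a)` of the expectation. -/
lemma integral_tilted_sub_le {U U' h : Ω → ℝ} (hU : BddMeas U) (hU' : BddMeas U')
    (hh : BddMeas h) {a c D : ℝ} (hd : ∀ x, |U x - U' x - c| ≤ a)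
    (hosc : ∀ x y, |h x - h y| ≤ D) :
    ∫ x, h x ∂(P.tilted U') - ∫ x, h x ∂(P.tilted U) ≤ (1 - Real.exp (-(2 * a))) * D := by
  have hne : Nonempty Ω := nonempty_of_isProbabilityMeasure P
  have p1 := isProbabilityMeasure_tilted_of_bddMeas P hU
  have p2 := isProbabilityMeasure_tilted_of_bddMeas P hU'
  obtain ⟨M, hM⟩ := hh.bdd
  have hbdd : BddBelow (range h) := ⟨-M, by rintro _ ⟨x, rfl⟩; exact (abs_le.1 (hM x)).1⟩
  set lo := ⨅ x, h x with hlo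
  have h0 : ∀ x, 0 ≤ h x - lo := fun x => sub_nonneg.2 (ciInf_le hbdd x)
  have h1 : ∀ x, h x - lo ≤ D := fun x => by
    have : h x - D ≤ lo := le_ciInf fun y => by
      have := (abs_le.1 (hosc x y)).2
      linarith
    linarith
  have key := exp_mul_integral_tilted_le P hU hU' (hh.sub (BddMeas.const lo)) h0 hd
  rw [integral_sub (hh.integrable _) (integrable_const _),
    integral_sub (hh.integrable _) (integrable_const _)] at key
  simp only [integral_const, probReal_univ, one_smul] at key
  have h2 : ∫ x, h x ∂(P.tilted U') - lo ≤ D := by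
    have := integral_mono (μ := P.tilted U') ((hh.sub (BddMeas.const lo)).integrable _)
      (integrable_const D) h1
    rw [integral_sub (hh.integrable _) (integrable_const _)] at this
    simpa using this
  have ha : 0 ≤ a := (abs_nonneg _).trans (hd hne.some)
  have h3 : 0 ≤ 1 - Real.exp (-(2 * a)) := by
    rw [sub_nonneg]; exact Real.exp_le_one_iff.2 (by linarith)
  nlinarith [mul_le_mul_of_nonneg_left h2 h3]

/-- Doeblin estimate: tilting by potentials that agree up to a constant and an error `a` changes
expectations by at most `1 - exp (-2a)` times the oscillation. -/
lemma abs_integral_tilted_sub_le {U U' h : Ω → ℝ} (hU : BddMeas U) (hU' : BddMeas U')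
    (hh : BddMeas h) {a c D : ℝ} (hd : ∀ x, |U x - U' x - c| ≤ a)
    (hosc : ∀ x y, |h x - h y| ≤ D) :
    |∫ x, h x ∂(P.tilted U) - ∫ x, h x ∂(P.tilted U')| ≤ (1 - Real.exp (-(2 * a))) * D := by
  rw [abs_sub_le_iff]
  refine ⟨integral_tilted_sub_le P hU' hU hh (c := -c) (fun x => ?_) hosc,
    integral_tilted_sub_le P hU hU' hh hd hosc⟩
  rw [show U' x - U x - -c = -(U x - U' x - c) by ring, abs_neg]
  exact hd x

lemma abs_integral_le_of_abs_le {f : Ω → ℝ} {M : ℝ} (hM : ∀ x, |f x| ≤ M) :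
    |∫ x, f x ∂P| ≤ M := by
  have := norm_integral_le_of_norm_le_const (μ := P) (f := f) (C := M)
    (Eventually.of_forall fun y => by simpa using hM _)
  simpa using this

/-- The mean absolute deviation is at most the standard deviation, hence at most `G` rather than the
trivial `2G`. This is what gives the covariance bound the constant `1`. -/
lemma integral_abs_sub_integral_le {g : Ω → ℝ} (hg : BddMeas g) {G : ℝ} (hG : ∀ x, |g x| ≤ G) :
    ∫ x, |g x - ∫ y, g y ∂P| ∂P ≤ G := by
  have hG0 : 0 ≤ G := (abs_nonneg _).trans (hG (nonempty_of_isProbabilityMeasure P).some)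
  set e := ∫ y, g y ∂P with he
  set d := ∫ x, |g x - e| ∂P with hd'
  have hb : BddMeas (fun x => g x - e) := hg.sub (BddMeas.const e)
  have hba : BddMeas (fun x => |g x - e|) := by
    obtain ⟨M, hM⟩ := hb.bdd
    exact ⟨hb.measurable.abs, M, fun x => by simpa using hM x⟩
  have h1 : 0 ≤ ∫ x, (|g x - e| - d) * (|g x - e| - d) ∂P :=
    integral_nonneg fun x => mul_self_nonneg _
  have h2 : ∫ x, (|g x - e| - d) * (|g x - e| - d) ∂P = ∫ x, g x * g x ∂P - e * e - d * d := by
    have : ∀ x, (|g x - e| - d) * (|g x - e| - d)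
        = g x * g x - 2 * e * g x + e * e - 2 * d * |g x - e| + d * d := fun x => by
      have := abs_mul_abs_self (g x - e)
      linear_combination this
    simp_rw [this]
    rw [integral_add, integral_sub, integral_add, integral_sub]
    · simp only [integral_const_mul, integral_const, probReal_univ, one_smul]
      rw [← he, ← hd']
      ring
    all_goals
      first
      | exact (hg.mul hg).integrable P
      | exact (hg.integrable P).const_mul _
      | exact integrable_const _
      | exact (hba.integrable P).const_mul _
      | exact ((hg.mul hg).integrable P).sub ((hg.integrable P).const_mul _)
      | exact (((hg.mul hg).integrable P).sub ((hg.integrable P).const_mul _)).add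
          (integrable_const _)
      | exact ((((hg.mul hg).integrable P).sub ((hg.integrable P).const_mul _)).add
          (integrable_const _)).sub ((hba.integrable P).const_mul _)
  have h3 : ∫ x, g x * g x ∂P ≤ G * G := by
    have := integral_mono ((hg.mul hg).integrable P) (integrable_const (G * G)) (fun x => by
      have := hG x
      rw [← abs_mul_abs_self]
      exact mul_self_le_mul_self (abs_nonneg _) this)
    simpa using this
  refine abs_le_of_sq_le_sq' ?_ hG0 |>.2
  nlinarith [mul_self_nonneg e]

/-- The covariance of two bounded functions, one of which has small oscillation. -/
lemma abs_cov_le_of_osc {F g : Ω → ℝ} (hF : BddMeas F) (hg : BddMeas g) {D G : ℝ}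
    (hosc : ∀ x y, |F x - F y| ≤ 2 * D) (hG : ∀ x, |g x| ≤ G) :
    |∫ x, F x * g x ∂P - (∫ x, F x ∂P) * ∫ x, g x ∂P| ≤ D * G := by
  have hne : Nonempty Ω := nonempty_of_isProbabilityMeasure P
  obtain ⟨M, hM⟩ := hF.bdd
  have hbb : BddBelow (range F) := ⟨-M, by rintro _ ⟨x, rfl⟩; exact (abs_le.1 (hM x)).1⟩
  have hba : BddAbove (range F) := ⟨M, by rintro _ ⟨x, rfl⟩; exact (abs_le.1 (hM x)).2⟩
  set lo := ⨅ x, F x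
  set hi := ⨆ x, F x
  have h1 : hi ≤ lo + 2 * D := ciSup_le fun x => by
    have : F x - 2 * D ≤ lo := le_ciInf fun y => by
      have := (abs_le.1 (hosc x y)).2
      linarith
    linarith
  -- The midpoint of the range: the deviation of `F` from it is half the oscillation.
  set c := lo + D
  have hc : ∀ x, |F x - c| ≤ D := fun x => by
    have a1 := ciInf_le hbb x
    have a2 := le_ciSup hba x
    rw [abs_le]
    constructor <;> simp only [c] <;> linarith
  set e := ∫ y, g y ∂P with he
  have hid : ∫ x, F x * g x ∂P - (∫ x, F x ∂P) * e = ∫ x, (F x - c) * (g x - e) ∂P := by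
    have : ∀ x, (F x - c) * (g x - e) = F x * g x - e * F x - c * g x + c * e := fun x => by ring
    simp_rw [this]
    rw [integral_add, integral_sub, integral_sub]
    · simp only [integral_const_mul, integral_const, probReal_univ, one_smul]
      rw [← he]
      ring
    all_goals
      first
      | exact (hF.mul hg).integrable P
      | exact (hg.integrable P).const_mul _
      | exact (hF.integrable P).const_mul _
      | exact integrable_const _
      | exact ((hF.mul hg).integrable P).sub ((hF.integrable P).const_mul _)
      | exact (((hF.mul hg).integrable P).sub ((hF.integrable P).const_mul _)).sub
          ((hg.integrable P).const_mul _)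
  have hD : 0 ≤ D := (abs_nonneg _).trans (hc hne.some)
  rw [hid]
  calc |∫ x, (F x - c) * (g x - e) ∂P| ≤ ∫ x, |(F x - c) * (g x - e)| ∂P :=
        abs_integral_le_integral_abs
    _ ≤ ∫ x, D * |g x - e| ∂P := by
        refine integral_mono ?_ ?_ fun x => ?_
        · exact (((hF.sub (BddMeas.const c)).mul (hg.sub (BddMeas.const e))).integrable P).abs
        · exact (((hg.sub (BddMeas.const e)).integrable P).abs).const_mul _
        · dsimp only
          rw [abs_mul]
          exact mul_le_mul_of_nonneg_right (hc x) (abs_nonneg _)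
    _ = D * ∫ x, |g x - e| ∂P := integral_const_mul _ _
    _ ≤ D * G := mul_le_mul_of_nonneg_left (integral_abs_sub_integral_le P hg hG) hD

end Tilted

/-! ### The i.i.d. reference measure and conditional expectations. -/

section

open Classical in
/-- The configuration that equals `ω` on `R` and `x` off `R`. -/
def merge (R : Set ℤ) (ω x : ℤ → ℝ) : ℤ → ℝ := fun i => if i ∈ R then ω i else x i

lemma merge_of_mem {R : Set ℤ} {ω x : ℤ → ℝ} {i : ℤ} (h : i ∈ R) : merge R ω x i = ω i := by
  simp [merge, h]

lemma merge_of_notMem {R : Set ℤ} {ω x : ℤ → ℝ} {i : ℤ} (h : i ∉ R) : merge R ω x i = x i := by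
  simp [merge, h]

lemma merge_merge_left (R : Set ℤ) (ω ω' x : ℤ → ℝ) :
    merge R ω (merge R ω' x) = merge R ω x := by
  ext i; by_cases h : i ∈ R <;> simp [merge, h]

lemma merge_merge_of_subset {R S : Set ℤ} (hRS : R ⊆ S) (ω ω' x : ℤ → ℝ) :
    merge S (merge R ω ω') x = merge R ω (merge S ω' x) := by
  ext i
  by_cases h : i ∈ R
  · simp [merge, h, hRS h]
  · simp [merge, h]

lemma measurable_merge (R : Set ℤ) :
    Measurable fun p : (ℤ → ℝ) × (ℤ → ℝ) => merge R p.1 p.2 := by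
  refine measurable_pi_lambda _ fun i => ?_
  by_cases h : i ∈ R <;> simp only [merge, h, if_true, if_false] <;> fun_prop

lemma measurable_merge_left (R : Set ℤ) (x : ℤ → ℝ) : Measurable fun ω => merge R ω x :=
  (measurable_merge R).comp (measurable_id.prodMk measurable_const)

/-- The law of an i.i.d. family indexed by `ℤ`. -/
def iid (ν : Measure ℝ) [IsProbabilityMeasure ν] : Measure (ℤ → ℝ) :=
  Measure.infinitePi fun _ => ν

variable (ν : Measure ℝ) [IsProbabilityMeasure ν]

instance : IsProbabilityMeasure (iid ν) := by unfold iid; infer_instance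

/-- Resampling the coordinates in `R` independently preserves the i.i.d. law. -/
lemma map_merge (R : Set ℤ) :
    ((iid ν).prod (iid ν)).map (fun p : (ℤ → ℝ) × (ℤ → ℝ) => merge R p.1 p.2) = iid ν := by
  classical
  refine Measure.eq_infinitePi _ fun s t ht => ?_
  rw [Measure.map_apply (measurable_merge R) (MeasurableSet.pi s.countable_toSet fun i _ => ht i)]
  have : (fun p : (ℤ → ℝ) × (ℤ → ℝ) => merge R p.1 p.2) ⁻¹' (Set.pi s t)
      = (Set.pi (s.filter (· ∈ R) : Finset ℤ) t) ×ˢ (Set.pi (s.filter (· ∉ R) : Finset ℤ) t) := by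
    ext p
    simp only [mem_preimage, Set.mem_pi, Finset.mem_coe, mem_prod, Finset.mem_filter]
    constructor
    · intro h
      exact ⟨fun i hi => by simpa [merge, hi.2] using h i hi.1,
        fun i hi => by simpa [merge, hi.2] using h i hi.1⟩
    · rintro ⟨h1, h2⟩ i hi
      by_cases hR : i ∈ R
      · simpa [merge, hR] using h1 i ⟨hi, hR⟩
      · simpa [merge, hR] using h2 i ⟨hi, hR⟩
  rw [this, Measure.prod_prod, iid, Measure.infinitePi_pi _ fun i _ => ht i,
    Measure.infinitePi_pi _ fun i _ => ht i, Finset.prod_filter_mul_prod_filter_not]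

lemma integral_iid_eq_integral_merge (R : Set ℤ) {F : (ℤ → ℝ) → ℝ} (hF : BddMeas F) :
    ∫ ω, F ω ∂(iid ν) = ∫ x, ∫ ω, F (merge R ω x) ∂(iid ν) ∂(iid ν) := by
  have hF2 : BddMeas (fun p : (ℤ → ℝ) × (ℤ → ℝ) => F (merge R p.1 p.2)) :=
    hF.comp (measurable_merge R)
  conv_lhs => rw [← map_merge ν R]
  rw [integral_map (measurable_merge R).aemeasurable hF.measurable.aestronglyMeasurable,
    integral_prod_symm _ (hF2.integrable _)]

/-- The expectation of `f` under the Gibbs measure with potential `U`, given that the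
configuration off `R` is `x`. -/
def condE (R : Set ℤ) (U f : (ℤ → ℝ) → ℝ) (x : ℤ → ℝ) : ℝ :=
  ∫ ω, f (merge R ω x) ∂((iid ν).tilted fun ω => U (merge R ω x))

lemma condE_eq_div (R : Set ℤ) (U f : (ℤ → ℝ) → ℝ) (x : ℤ → ℝ) :
    condE ν R U f x = (∫ ω, Real.exp (U (merge R ω x)) * f (merge R ω x) ∂(iid ν))
      / ∫ ω, Real.exp (U (merge R ω x)) ∂(iid ν) :=
  integral_tilted_eq_div _ _ _

lemma condE_merge (R : Set ℤ) (U f : (ℤ → ℝ) → ℝ) (ω x : ℤ → ℝ) :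
    condE ν R U f (merge R ω x) = condE ν R U f x := by
  simp only [condE, merge_merge_left]

lemma bddMeas_condE (R : Set ℤ) {U f : (ℤ → ℝ) → ℝ} (hU : BddMeas U) (hf : BddMeas f) :
    BddMeas (condE ν R U f) := by
  obtain ⟨M, hM⟩ := hf.bdd
  have hsw : Measurable fun p : (ℤ → ℝ) × (ℤ → ℝ) => merge R p.2 p.1 :=
    (measurable_merge R).comp measurable_swap
  refine ⟨?_, M, fun x => ?_⟩
  · rw [show condE ν R U f = fun x => _ from funext fun x => condE_eq_div ν R U f x]
    exact (((hU.exp.mul hf).comp hsw).integral_right (iid ν)).measurable.div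
      ((hU.exp.comp hsw).integral_right (iid ν)).measurable
  · have := isProbabilityMeasure_tilted_of_bddMeas (iid ν) (hU.comp (measurable_merge_left R x))
    exact abs_integral_le_of_abs_le _ fun ω => hM _

/-- The tower property. -/
lemma integral_tilted_eq_integral_condE (R : Set ℤ) {U f : (ℤ → ℝ) → ℝ} (hU : BddMeas U)
    (hf : BddMeas f) :
    ∫ ω, f ω ∂((iid ν).tilted U) = ∫ x, condE ν R U f x ∂((iid ν).tilted U) := by
  rw [integral_tilted_eq_div, integral_tilted_eq_div]
  congr 1
  rw [integral_iid_eq_integral_merge ν R (hU.exp.mul hf),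
    integral_iid_eq_integral_merge ν R (hU.exp.mul (bddMeas_condE ν R hU hf))]
  congr 1 with x
  -- The conditional expectation does not see the resampled coordinates, so it leaves the inner
  -- integral and its denominator cancels.
  simp only [condE_merge]
  rw [integral_mul_const, condE_eq_div, mul_div_cancel₀]
  exact (integral_exp_pos_of_bddMeas (iid ν) (hU.comp (measurable_merge_left R x))).ne'

/-- Consistency of the specification: the tower property with the coordinates off `S` frozen at `x`.
-/
lemma condE_eq_integral_condE {R S : Set ℤ} (hRS : R ⊆ S) {U f : (ℤ → ℝ) → ℝ} (hU : BddMeas U)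
    (hf : BddMeas f) (x : ℤ → ℝ) :
    condE ν S U f x = ∫ ω, condE ν R U f (merge S ω x)
      ∂((iid ν).tilted fun ω => U (merge S ω x)) := by
  rw [condE, integral_tilted_eq_integral_condE ν R (hU.comp (measurable_merge_left S x))
    (hf.comp (measurable_merge_left S x))]
  simp only [condE, merge_merge_of_subset hRS]

lemma condE_mul_of_dependsOn_compl {R : Set ℤ} {U f g : (ℤ → ℝ) → ℝ} (hg : DependsOn g Rᶜ)
    (x : ℤ → ℝ) : condE ν R U (fun ω => f ω * g ω) x = condE ν R U f x * g x := by
  have : ∀ ω, g (merge R ω x) = g x := fun ω => hg fun i hi => merge_of_notMem hi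
  simp only [condE, this, integral_mul_const]

end

/-! ### Many-body interactions on `ℤ` and their cuts. -/

section

/-- The interaction of the pair of particles that delimits the spacings `i, …, j`. -/
def pairTerm (Φ : ℕ → ℝ → ℝ) (i j : ℤ) (ω : ℤ → ℝ) : ℝ :=
  Φ (j + 1 - i).toNat (∑ l ∈ Finset.Icc i j, ω l)

/-- The interactions `pairTerm Φ i j` with `A ≤ i < b` and `b' ≤ j < B`. -/
def crossE (Φ : ℕ → ℝ → ℝ) (A b b' B : ℤ) (ω : ℤ → ℝ) : ℝ :=
  ∑ i ∈ Finset.Ico A b, ∑ j ∈ Finset.Ico b' B, pairTerm Φ i j ω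

/-- The total interaction of the spacings in `[A, B)`. -/
def ham (Φ : ℕ → ℝ → ℝ) (A B : ℤ) (ω : ℤ → ℝ) : ℝ := crossE Φ A B A B ω

/-- A many-body interaction between at least two spacings, decaying like `n ^ (-s)` in the number
`n` of spacings involved. -/
structure IsInteraction (Φ : ℕ → ℝ → ℝ) (b s : ℝ) : Prop where
  measurable : ∀ n, Measurable (Φ n)
  eq_zero_of_le_one : ∀ n r, n ≤ 1 → Φ n r = 0
  abs_le : ∀ n r, |Φ n r| ≤ b * (n : ℝ) ^ (-s)

variable {Φ : ℕ → ℝ → ℝ} {b₀ s : ℝ}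

lemma pairTerm_eq_zero (hΦ : IsInteraction Φ b₀ s) {i j : ℤ} (h : j ≤ i) (ω : ℤ → ℝ) :
    pairTerm Φ i j ω = 0 := hΦ.eq_zero_of_le_one _ _ (by omega)

lemma bddMeas_pairTerm (hΦ : IsInteraction Φ b₀ s) (i j : ℤ) : BddMeas (pairTerm Φ i j) := by
  refine ⟨(hΦ.measurable _).comp (Finset.measurable_sum _ fun l _ => measurable_pi_apply l), _,
    fun ω => hΦ.abs_le _ _⟩

lemma bddMeas_ham (hΦ : IsInteraction Φ b₀ s) (A B : ℤ) : BddMeas (ham Φ A B) := by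
  unfold ham crossE
  exact BddMeas.sum _ fun i _ => BddMeas.sum _ fun j _ => bddMeas_pairTerm hΦ i j

lemma ham_dependsOn (Φ : ℕ → ℝ → ℝ) (A B : ℤ) : DependsOn (ham Φ A B) (Ico A B) := by
  intro x y h
  unfold ham crossE
  refine Finset.sum_congr rfl fun i hi => Finset.sum_congr rfl fun j hj => ?_
  rw [pairTerm, pairTerm]
  congr 1
  refine Finset.sum_congr rfl fun l hl => h l ?_
  simp only [Finset.mem_Ico, Finset.mem_Icc, mem_Ico] at *
  omega

lemma sum_Ico_consec {a b c : ℤ} (hab : a ≤ b) (hbc : b ≤ c) (f : ℤ → ℝ) :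
    ∑ i ∈ Finset.Ico a c, f i = ∑ i ∈ Finset.Ico a b, f i + ∑ i ∈ Finset.Ico b c, f i := by
  rw [← Finset.Ico_union_Ico_eq_Ico hab hbc,
    Finset.sum_union (Finset.Ico_disjoint_Ico_consecutive a b c)]

lemma ham_split (hΦ : IsInteraction Φ b₀ s) {A b B : ℤ} (h1 : A ≤ b) (h2 : b ≤ B) (ω : ℤ → ℝ) :
    ham Φ A B ω = ham Φ A b ω + ham Φ b B ω + crossE Φ A b b B ω := by
  have h0 : ∑ i ∈ Finset.Ico b B, ∑ j ∈ Finset.Ico A b, pairTerm Φ i j ω = 0 :=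
    Finset.sum_eq_zero fun i hi => Finset.sum_eq_zero fun j hj =>
      pairTerm_eq_zero hΦ (by simp only [Finset.mem_Ico] at hi hj; omega) ω
  simp only [ham, crossE]
  rw [sum_Ico_consec h1 h2]
  simp_rw [fun i => sum_Ico_consec h1 h2 (fun j => pairTerm Φ i j ω), Finset.sum_add_distrib]
  rw [h0]
  ring

/-- Inclusion-exclusion: the volumes `[A, b')` and `[b, B)` overlap in `[b, b')`, and together they
miss exactly the pairs that straddle that block. -/
lemma ham_split_far (hΦ : IsInteraction Φ b₀ s) {A b b' B : ℤ} (h1 : A ≤ b) (h2 : b ≤ b')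
    (h3 : b' ≤ B) (ω : ℤ → ℝ) :
    ham Φ A B ω = ham Φ A b' ω - ham Φ b b' ω + ham Φ b B ω + crossE Φ A b b' B ω := by
  rw [ham_split hΦ h1 (h2.trans h3), ham_split hΦ h1 h2]
  have : crossE Φ A b b B ω = crossE Φ A b b b' ω + crossE Φ A b b' B ω := by
    simp only [crossE]
    simp_rw [fun i => sum_Ico_consec h2 h3 (fun j => pairTerm Φ i j ω), Finset.sum_add_distrib]
  rw [this]
  ring

/-- Bound on the interaction across one cut. -/
def CrossBound (Φ : ℕ → ℝ → ℝ) (K : ℝ) : Prop :=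
  ∀ (A b B : ℤ) (ω : ℤ → ℝ), |crossE Φ A b b B ω| ≤ K

/-- Bound on the interaction across a block of `L` spacings. -/
def FarBound (Φ : ℕ → ℝ → ℝ) (L : ℕ) (κ : ℝ) : Prop :=
  ∀ (A b B : ℤ) (ω : ℤ → ℝ), |crossE Φ A b (b + L) B ω| ≤ κ

/-- Left of the cut both configurations equal `ω`, so these energies cancel. The energies right of
the cut do not involve `ω` and act as a constant in the tilt. Only two cross terms remain. -/
lemma abs_ham_merge_sub_le (hΦ : IsInteraction Φ b₀ s) {K : ℝ} (hK : CrossBound Φ K)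
    {A b B B' : ℤ} (h1 : A ≤ b) (h2 : b ≤ B) (h3 : b ≤ B') (x x' ω : ℤ → ℝ) :
    |ham Φ A B (merge (Iio b) ω x) - ham Φ A B' (merge (Iio b) ω x')
      - (ham Φ b B x - ham Φ b B' x')| ≤ 2 * K := by
  have e1 : ham Φ A b (merge (Iio b) ω x) = ham Φ A b (merge (Iio b) ω x') :=
    ham_dependsOn Φ A b fun i hi => by
      rw [merge_of_mem (mem_Iio.2 hi.2), merge_of_mem (mem_Iio.2 hi.2)]
  have e2 : ∀ C y, ham Φ b C (merge (Iio b) ω y) = ham Φ b C y := fun C y =>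
    ham_dependsOn Φ b C fun i hi => merge_of_notMem (by simpa using hi.1)
  rw [ham_split hΦ h1 h2, ham_split hΦ h1 h3, e1, e2, e2]
  have k1 := abs_le.1 (hK A b B (merge (Iio b) ω x))
  have k2 := abs_le.1 (hK A b B' (merge (Iio b) ω x'))
  rw [abs_le]
  constructor <;> linarith [k1.1, k1.2, k2.1, k2.2]

/-- The agreement of `x` and `x'` on the block makes everything inside `[A, b + L)` cancel, so only
interactions across the whole block remain. -/
lemma abs_ham_merge_sub_le_of_eqOn (hΦ : IsInteraction Φ b₀ s) {L : ℕ} {κ : ℝ}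
    (hκ : FarBound Φ L κ) {A b B B' : ℤ} (h1 : A ≤ b) (h2 : b + L ≤ B) (h3 : b + L ≤ B')
    {x x' : ℤ → ℝ} (hx : ∀ i, b ≤ i → i < b + L → x i = x' i) (ω : ℤ → ℝ) :
    |ham Φ A B (merge (Iio b) ω x) - ham Φ A B' (merge (Iio b) ω x')
      - (ham Φ b B x - ham Φ b B' x')| ≤ 2 * κ := by
  have hL : b ≤ b + L := by omega
  have e1 : ham Φ A (b + L) (merge (Iio b) ω x) = ham Φ A (b + L) (merge (Iio b) ω x') :=
    ham_dependsOn Φ A (b + L) fun i hi => by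
      by_cases hib : i < b
      · rw [merge_of_mem (mem_Iio.2 hib), merge_of_mem (mem_Iio.2 hib)]
      · rw [merge_of_notMem (by simpa using hib), merge_of_notMem (by simpa using hib)]
        exact hx i (not_lt.1 hib) hi.2
  have e2 : ∀ C y, ham Φ b C (merge (Iio b) ω y) = ham Φ b C y := fun C y =>
    ham_dependsOn Φ b C fun i hi => merge_of_notMem (by simpa using hi.1)
  have e3 : ham Φ b (b + L) x = ham Φ b (b + L) x' :=
    ham_dependsOn Φ b (b + L) fun i hi => hx i hi.1 hi.2
  rw [ham_split_far hΦ h1 hL h2, ham_split_far hΦ h1 hL h3, e1, e2, e2, e2, e2, e3]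
  have k1 := abs_le.1 (hκ A b B (merge (Iio b) ω x))
  have k2 := abs_le.1 (hκ A b B' (merge (Iio b) ω x'))
  rw [abs_le]
  constructor <;> linarith [k1.1, k1.2, k2.1, k2.2]

/-! ### Summation of the decay -/

/-- The integral test in telescoping form, from `log t ≤ t - 1` and `1 + u ≤ exp u`. -/
lemma mul_rpow_neg_le_sub {x σ : ℝ} (hx : 0 < x) (hσ : 1 < σ) :
    (σ - 1) * (x + 1) ^ (-σ) ≤ x ^ (1 - σ) - (x + 1) ^ (1 - σ) := by
  have hx1 : 0 < x + 1 := by linarith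
  have h1 : (x + 1) ^ (1 - σ) = (x + 1) ^ (-σ) * (x + 1) := by
    rw [show 1 - σ = -σ + 1 by ring, Real.rpow_add_one hx1.ne']
  have h2 : (x + 1) ^ (1 - σ) * (1 + (σ - 1) / (x + 1)) ≤ x ^ (1 - σ) := by
    have h3 : 1 + (σ - 1) / (x + 1) ≤ (x / (x + 1)) ^ (1 - σ) := by
      rw [Real.rpow_def_of_pos (by positivity)]
      have hl : Real.log (x / (x + 1)) ≤ x / (x + 1) - 1 := Real.log_le_sub_one_of_pos (by positivity)
      have hl' : x / (x + 1) - 1 = -(1 / (x + 1)) := by field_simp; ring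
      calc 1 + (σ - 1) / (x + 1) ≤ Real.log (x / (x + 1)) * (1 - σ) + 1 := by
            have : (σ - 1) / (x + 1) = -(1 / (x + 1)) * (1 - σ) := by field_simp; ring
            rw [this, ← hl']
            nlinarith
        _ ≤ _ := Real.add_one_le_exp _
    calc (x + 1) ^ (1 - σ) * (1 + (σ - 1) / (x + 1))
        ≤ (x + 1) ^ (1 - σ) * (x / (x + 1)) ^ (1 - σ) := by gcongr
      _ = x ^ (1 - σ) := by
        rw [← Real.mul_rpow hx1.le (by positivity)]
        congr 1
        field_simp
  rw [h1] at h2 ⊢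
  have : (x + 1) ^ (-σ) * (x + 1) * (1 + (σ - 1) / (x + 1))
      = (x + 1) ^ (-σ) * (x + 1) + (σ - 1) * (x + 1) ^ (-σ) := by field_simp
  linarith

lemma sum_rpow_neg_le {x σ : ℝ} (hx : 0 < x) (hσ : 1 < σ) (N : ℕ) :
    ∑ e ∈ Finset.range N, (x + e + 1) ^ (-σ) ≤ x ^ (1 - σ) / (σ - 1) := by
  have hσ' : 0 < σ - 1 := by linarith
  -- Keeping the bound for the tail on the left makes the induction telescope.
  have key : ∑ e ∈ Finset.range N, (x + e + 1) ^ (-σ) + (x + N) ^ (1 - σ) / (σ - 1)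
      ≤ x ^ (1 - σ) / (σ - 1) := by
    induction N with
    | zero => simp
    | succ N ih =>
      rw [Finset.sum_range_succ]
      refine le_trans ?_ ih
      have hxN : 0 < x + N := by positivity
      have h := mul_rpow_neg_le_sub hxN hσ
      have h' : (x + N + 1) ^ (-σ)
          ≤ (x + N) ^ (1 - σ) / (σ - 1) - (x + N + 1) ^ (1 - σ) / (σ - 1) := by
        rw [← sub_div, le_div_iff₀ hσ']
        linarith
      push_cast
      rw [← add_assoc x]
      linarith
  have : 0 ≤ (x + N) ^ (1 - σ) / (σ - 1) := by positivity
  linarith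

/-- Two integral tests, with exponents `s` and `s - 1`; the second one needs `s > 2`. -/
lemma sum_sum_rpow_neg_le {x : ℝ} (hx : 0 < x) (hs : 2 < s) (N N' : ℕ) :
    ∑ d ∈ Finset.range N, ∑ e ∈ Finset.range N', (x + d + e + 2) ^ (-s)
      ≤ x ^ (2 - s) / ((s - 1) * (s - 2)) := by
  have h1 : ∀ d ∈ Finset.range N, ∑ e ∈ Finset.range N', (x + d + e + 2) ^ (-s)
      ≤ (x + d + 1) ^ (-(s - 1)) / (s - 1) := fun d _ => by
    have := sum_rpow_neg_le (x := x + d + 1) (by positivity) (show 1 < s by linarith) N'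
    rw [show 1 - s = -(s - 1) by ring] at this
    refine le_trans (le_of_eq (Finset.sum_congr rfl fun e _ => ?_)) this
    congr 1
    ring
  refine (Finset.sum_le_sum h1).trans ?_
  rw [← Finset.sum_div]
  have h2 := sum_rpow_neg_le hx (show 1 < s - 1 by linarith) N
  rw [show 1 - (s - 1) = 2 - s by ring, show s - 1 - 1 = s - 2 by ring] at h2
  have hs1 : 0 < s - 1 := by linarith
  calc _ ≤ x ^ (2 - s) / (s - 2) / (s - 1) := by gcongr
    _ = _ := by rw [div_div, mul_comm (s - 2)]

/-- Here `d` and `e` count the spacings strictly between the end spacings of the pair and the block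
on either side, so `L + d + e + 2` spacings are involved. -/
lemma abs_crossE_le (hΦ : IsInteraction Φ b₀ s) (A b B : ℤ) (L : ℕ) (ω : ℤ → ℝ) :
    |crossE Φ A b (b + L) B ω| ≤ ∑ d ∈ Finset.range (b - A).toNat,
      ∑ e ∈ Finset.range (B - (b + L)).toNat, b₀ * ((L : ℝ) + d + e + 2) ^ (-s) := by
  have h1 : |crossE Φ A b (b + L) B ω| ≤ ∑ i ∈ Finset.Ico A b, ∑ j ∈ Finset.Ico (b + L) B,
      b₀ * (((j + 1 - i).toNat : ℕ) : ℝ) ^ (-s) :=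
    (Finset.abs_sum_le_sum_abs _ _).trans (Finset.sum_le_sum fun i _ =>
      (Finset.abs_sum_le_sum_abs _ _).trans (Finset.sum_le_sum fun j _ => hΦ.abs_le _ _))
  refine h1.trans (le_of_eq ?_)
  refine Finset.sum_bij' (fun i _ => (b - 1 - i).toNat) (fun d _ => b - 1 - d) ?_ ?_ ?_ ?_ ?_
  · intro i hi; simp only [Finset.mem_Ico, Finset.mem_range] at *; omega
  · intro i hi; simp only [Finset.mem_Ico, Finset.mem_range] at *; omega
  · intro i hi; simp only [Finset.mem_Ico] at *; omega
  · intro i hi; simp only [Finset.mem_range] at *; omega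
  intro i hi
  refine Finset.sum_bij' (fun j _ => (j - (b + L)).toNat) (fun e _ => b + L + e) ?_ ?_ ?_ ?_ ?_
  · intro i hi; simp only [Finset.mem_Ico, Finset.mem_range] at *; omega
  · intro i hi; simp only [Finset.mem_Ico, Finset.mem_range] at *; omega
  · intro i hi; simp only [Finset.mem_Ico] at *; omega
  · intro i hi; simp only [Finset.mem_range] at *; omega
  intro j hj
  simp only [Finset.mem_Ico] at hi hj
  have : (j + 1 - i).toNat = L + (b - 1 - i).toNat + (j - (b + L)).toNat + 2 := by omega
  rw [this]
  push_cast
  rfl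

/-- The constant in the decay of the interaction across a block. -/
def decayConst (s : ℝ) : ℝ := 1 / ((s - 1) * (s - 2))

lemma decayConst_pos (hs : 2 < s) : 0 < decayConst s :=
  one_div_pos.2 (mul_pos (by linarith) (by linarith))

lemma farBound (hΦ : IsInteraction Φ b₀ s) (hb₀ : 0 ≤ b₀) (hs : 2 < s) {L : ℕ} (hL : 1 ≤ L) :
    FarBound Φ L (b₀ * decayConst s * (L : ℝ) ^ (2 - s)) := by
  intro A b B ω
  refine (abs_crossE_le hΦ A b B L ω).trans ?_
  simp_rw [← Finset.mul_sum]
  rw [mul_assoc]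
  refine mul_le_mul_of_nonneg_left ?_ hb₀
  refine (sum_sum_rpow_neg_le (by positivity) hs _ _).trans (le_of_eq ?_)
  rw [decayConst]; ring

/-- For a bare cut the double sum would start at `x = 0`, where its bound is not available.
Comparing `d + e + 2` with `(d + e + 3) / 2` moves the start to `x = 1` at the cost of `2 ^ s`. -/
lemma crossBound (hΦ : IsInteraction Φ b₀ s) (hb₀ : 0 ≤ b₀) (hs : 2 < s) :
    CrossBound Φ (b₀ * (2 ^ s * decayConst s)) := by
  intro A b B ω
  have h := abs_crossE_le hΦ A b B 0 ω
  simp only [Nat.cast_zero, add_zero] at h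
  refine h.trans ?_
  simp_rw [← Finset.mul_sum]
  refine mul_le_mul_of_nonneg_left ?_ hb₀
  calc _ ≤ ∑ d ∈ Finset.range (b - A).toNat, ∑ e ∈ Finset.range (B - b).toNat,
        2 ^ s * ((1 : ℝ) + d + e + 2) ^ (-s) := by
        refine Finset.sum_le_sum fun d _ => Finset.sum_le_sum fun e _ => ?_
        have e1 : (2 : ℝ) ^ s * (1 + d + e + 2) ^ (-s) = ((1 + d + e + 2) / 2) ^ (-s) := by
          rw [Real.div_rpow (by positivity) (by norm_num), Real.rpow_neg (by norm_num : (0:ℝ) ≤ 2)]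
          field_simp
        rw [e1]
        refine Real.rpow_le_rpow_of_nonpos (by positivity) ?_ (by linarith)
        have : (0 : ℝ) ≤ d := by positivity
        have : (0 : ℝ) ≤ e := by positivity
        linarith
    _ ≤ 2 ^ s * decayConst s := by
        simp_rw [← Finset.mul_sum]
        refine mul_le_mul_of_nonneg_left ?_ (by positivity)
        refine (sum_sum_rpow_neg_le one_pos hs _ _).trans (le_of_eq ?_)
        rw [decayConst, Real.one_rpow]

/-- Interactions between at most `m` spacings do not act across a block of `m - 1` spacings. -/
lemma farBound_zero {L : ℕ} (h : ∀ n r, L + 2 ≤ n → Φ n r = 0) : FarBound Φ L 0 := by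
  intro A b B ω
  rw [crossE, Finset.sum_eq_zero, abs_zero]
  refine fun i hi => Finset.sum_eq_zero fun j hj => h _ _ ?_
  simp only [Finset.mem_Ico] at hi hj
  omega

end

/-! ### Loss of memory and decay of covariances in finite volume. -/

section

/-- The rate of loss of memory after `q` further blocks. -/
def oscRate (K κ : ℝ) : ℕ → ℝ
  | 0 => 1 - Real.exp (-(4 * K))
  | q + 1 => (1 - Real.exp (-(4 * K))) * oscRate K κ q + (1 - Real.exp (-(4 * κ)))

/-- The recursion is affine with slope `1 - exp (-4K)`; its fixed point is the increment divided by
`exp (-4K)`, which explains the prefactor `exp (4K)`. -/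
lemma oscRate_le {K κ : ℝ} (hK : 0 ≤ K) (hκ : 0 ≤ κ) (q : ℕ) :
    oscRate K κ q ≤ (1 - Real.exp (-(4 * K))) ^ (q + 1)
      + Real.exp (4 * K) * (1 - Real.exp (-(4 * κ))) := by
  have hε : 0 ≤ 1 - Real.exp (-(4 * K)) := by
    rw [sub_nonneg]; exact Real.exp_le_one_iff.2 (by linarith)
  have hδ : 0 ≤ 1 - Real.exp (-(4 * κ)) := by
    rw [sub_nonneg]; exact Real.exp_le_one_iff.2 (by linarith)
  have hinv : Real.exp (-(4 * K)) * Real.exp (4 * K) = 1 := by rw [← Real.exp_add]; simp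
  induction q with
  | zero =>
    have := mul_nonneg (Real.exp_pos (4 * K)).le hδ
    simp only [oscRate, zero_add, pow_one]
    linarith
  | succ q ih =>
    have h := mul_le_mul_of_nonneg_left ih hε
    rw [oscRate]
    calc _ ≤ (1 - Real.exp (-(4 * K))) * ((1 - Real.exp (-(4 * K))) ^ (q + 1)
          + Real.exp (4 * K) * (1 - Real.exp (-(4 * κ)))) + (1 - Real.exp (-(4 * κ))) := by
          linarith
      _ = _ := by
          rw [pow_succ _ (q + 1)]
          linear_combination -(1 - Real.exp (-(4 * κ))) * hinv

lemma oscRate_zero_right (K : ℝ) (q : ℕ) :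
    oscRate K 0 q = (1 - Real.exp (-(4 * K))) ^ (q + 1) := by
  induction q with
  | zero => simp [oscRate]
  | succ q ih => rw [oscRate, ih]; simp [pow_succ]; ring

variable (ν : Measure ℝ) [IsProbabilityMeasure ν] {Φ : ℕ → ℝ → ℝ} {b₀ s : ℝ}

lemma CrossBound.nonneg {K : ℝ} (hK : CrossBound Φ K) : 0 ≤ K :=
  (abs_nonneg _).trans (hK 0 0 0 0)

lemma FarBound.nonneg {κ : ℝ} {L : ℕ} (hκ : FarBound Φ L κ) : 0 ≤ κ :=
  (abs_nonneg _).trans (hκ 0 0 0 0)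

/-- Loss of memory: the conditional expectation of a function of the spacings left of `b` depends
little on the spacings, and the volume, right of `b + q L`. -/
lemma abs_condE_sub_le (hΦ : IsInteraction Φ b₀ s) {K κ : ℝ} {L : ℕ} (hK : CrossBound Φ K)
    (hκ : FarBound Φ L κ) {A b : ℤ} (hAb : A ≤ b) {f : (ℤ → ℝ) → ℝ} (hf : BddMeas f)
    (hfb : DependsOn f (Iio b)) {D : ℝ} (hD : ∀ x y, |f x - f y| ≤ D) (q : ℕ) :
    ∀ (B B' : ℤ) (_ : b + q * L ≤ B) (_ : b + q * L ≤ B') (x x' : ℤ → ℝ),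
      |condE ν (Iio (b + q * L)) (ham Φ A B) f x - condE ν (Iio (b + q * L)) (ham Φ A B') f x'|
        ≤ oscRate K κ q * D := by
  have hfm : ∀ {c : ℤ}, b ≤ c → ∀ ω x, f (merge (Iio c) ω x) = f ω := fun hc ω x =>
    hfb fun i hi => merge_of_mem (mem_Iio.2 ((mem_Iio.1 hi).trans_le hc))
  have hH : ∀ C c x, BddMeas (fun ω => ham Φ A C (merge (Iio c) ω x)) := fun C c x =>
    (bddMeas_ham hΦ A C).comp (measurable_merge_left _ x)
  induction q with
  | zero =>
    intro B B' hB hB' x x'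
    simp only [Nat.cast_zero, zero_mul, add_zero] at *
    simp only [condE, hfm le_rfl, oscRate]
    have := abs_integral_tilted_sub_le (iid ν) (hH B b x) (hH B' b x') hf
      (abs_ham_merge_sub_le hΦ hK hAb hB hB' x x') hD
    rwa [← mul_assoc, show (2 : ℝ) * 2 = 4 by norm_num] at this
  | succ q ih =>
    intro B B' hB hB' x x'
    set c : ℤ := b + q * L with hc
    have hbc : b ≤ c := by rw [hc]; have : (0 : ℤ) ≤ q * L := by positivity
                           linarith
    have hc' : b + ((q + 1 : ℕ) : ℤ) * L = c + L := by rw [hc]; push_cast; ring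
    rw [hc'] at hB hB' ⊢
    have hAc : A ≤ c := hAb.trans hbc
    have hcL : c ≤ c + L := by omega
    have hsub : Iio c ⊆ Iio (c + L) := Iio_subset_Iio hcL
    rw [condE_eq_integral_condE ν hsub (bddMeas_ham hΦ A B) hf,
      condE_eq_integral_condE ν hsub (bddMeas_ham hΦ A B') hf]
    set T := (iid ν).tilted fun ω => ham Φ A B (merge (Iio (c + L)) ω x)
    set T' := (iid ν).tilted fun ω => ham Φ A B' (merge (Iio (c + L)) ω x')
    have hT' : IsProbabilityMeasure T' :=
      isProbabilityMeasure_tilted_of_bddMeas (iid ν) (hH B' (c + L) x')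
    set h := fun ω => condE ν (Iio c) (ham Φ A B) f (merge (Iio (c + L)) ω x)
    set h' := fun ω => condE ν (Iio c) (ham Φ A B') f (merge (Iio (c + L)) ω x')
    have hh : BddMeas h :=
      (bddMeas_condE ν (Iio c) (bddMeas_ham hΦ A B) hf).comp (measurable_merge_left _ x)
    have hh' : BddMeas h' :=
      (bddMeas_condE ν (Iio c) (bddMeas_ham hΦ A B') hf).comp (measurable_merge_left _ x')
    -- Same observable, different laws: `ih` with equal volumes bounds the oscillation of `h`, and
    -- one more cut contracts it.
    have s1 : |∫ ω, h ω ∂T - ∫ ω, h ω ∂T'| ≤ (1 - Real.exp (-(4 * K))) * (oscRate K κ q * D) := by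
      have := abs_integral_tilted_sub_le (iid ν) (hH B (c + L) x) (hH B' (c + L) x') hh
        (abs_ham_merge_sub_le hΦ hK (hAc.trans hcL) hB hB' x x')
        (D := oscRate K κ q * D) (fun y y' => ih B B (hcL.trans hB) (hcL.trans hB) _ _)
      rwa [show 2 * (2 * K) = 4 * K by ring] at this
    -- Same law, different observables: the two boundary conditions coincide with `ω` on `[c, c +
    -- L)`, so they differ only beyond a full block.
    have s2 : |∫ ω, h ω ∂T' - ∫ ω, h' ω ∂T'| ≤ (1 - Real.exp (-(4 * κ))) * D := by
      rw [← integral_sub (hh.integrable _) (hh'.integrable _)]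
      refine abs_integral_le_of_abs_le T' fun ω => ?_
      simp only [h, h', condE, hfm hbc]
      have := abs_integral_tilted_sub_le (iid ν) (hH B c (merge (Iio (c + L)) ω x))
        (hH B' c (merge (Iio (c + L)) ω x')) hf
        (abs_ham_merge_sub_le_of_eqOn hΦ hκ hAc hB hB' (fun i _ hi => by
          rw [merge_of_mem (mem_Iio.2 hi), merge_of_mem (mem_Iio.2 hi)])) hD
      rwa [← mul_assoc, show (2 : ℝ) * 2 = 4 by norm_num] at this
    calc |∫ ω, h ω ∂T - ∫ ω, h' ω ∂T'|
        ≤ |∫ ω, h ω ∂T - ∫ ω, h ω ∂T'| + |∫ ω, h ω ∂T' - ∫ ω, h' ω ∂T'| := abs_sub_le _ _ _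
      _ ≤ oscRate K κ (q + 1) * D := by rw [oscRate]; linarith

/-- Decay of correlations of the finite-volume Gibbs measure. -/
lemma abs_cov_tilted_ham_le (hΦ : IsInteraction Φ b₀ s) {K κ : ℝ} {L : ℕ} (hK : CrossBound Φ K)
    (hκ : FarBound Φ L κ) {A b B : ℤ} (q : ℕ) (hAb : A ≤ b) (hB : b + q * L ≤ B)
    {f g : (ℤ → ℝ) → ℝ} (hf : BddMeas f) (hg : BddMeas g)
    (hfb : DependsOn f (Iio b)) (hgb : DependsOn g (Ici (b + q * L)))
    {F G : ℝ} (hF : ∀ x, |f x| ≤ F) (hG : ∀ x, |g x| ≤ G) :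
    |∫ ω, f ω * g ω ∂((iid ν).tilted (ham Φ A B))
      - (∫ ω, f ω ∂((iid ν).tilted (ham Φ A B))) * ∫ ω, g ω ∂((iid ν).tilted (ham Φ A B))|
      ≤ oscRate K κ q * F * G := by
  have hH := bddMeas_ham hΦ A B
  have hp := isProbabilityMeasure_tilted_of_bddMeas (iid ν) hH
  rw [integral_tilted_eq_integral_condE ν (Iio (b + q * L)) hH (hf.mul hg),
    integral_tilted_eq_integral_condE ν (Iio (b + q * L)) hH hf]
  -- `g` is a function of the conditioning variables, so only `f` is averaged; its conditional
  -- expectation has small oscillation.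
  simp only [condE_mul_of_dependsOn_compl ν (R := Iio (b + q * L)) (U := ham Φ A B) (f := f)
    (g := g) (by rwa [compl_Iio])]
  refine abs_cov_le_of_osc _ (bddMeas_condE ν _ hH hf) hg (fun x y => ?_) hG
  refine (abs_condE_sub_le ν hΦ hK hκ hAb hf hfb (D := 2 * F) (fun x y => ?_) q B B hB hB x y).trans
    (le_of_eq (by ring))
  exact (abs_sub _ _).trans (by linarith [hF x, hF y])

end

/-! ### Finite-volume Gibbs measures and their infinite-volume limit. -/

section

variable (ν : Measure ℝ) [IsProbabilityMeasure ν] (Φ : ℕ → ℝ → ℝ)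

/-- The Gibbs measure in the volume `[A, B)`; the spacings outside are i.i.d. -/
def volGibbs (A B : ℤ) : Measure (ℤ → ℝ) := (iid ν).tilted (ham Φ A B)

variable {Φ} {b₀ s : ℝ}

lemma isProbabilityMeasure_volGibbs (hΦ : IsInteraction Φ b₀ s) (A B : ℤ) :
    IsProbabilityMeasure (volGibbs ν Φ A B) :=
  isProbabilityMeasure_tilted_of_bddMeas (iid ν) (bddMeas_ham hΦ A B)

/-! ### Symmetries -/

lemma measurable_comp_equiv (e : ℤ ≃ ℤ) : Measurable fun ω : ℤ → ℝ => fun i => ω (e i) :=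
  measurable_pi_lambda _ fun i => measurable_pi_apply (e i)

lemma map_comp_equiv_iid (e : ℤ ≃ ℤ) :
    (iid ν).map (fun ω : ℤ → ℝ => fun i => ω (e i)) = iid ν := by
  classical
  refine Measure.eq_infinitePi _ fun S t ht => ?_
  rw [Measure.map_apply (measurable_comp_equiv e)
    (MeasurableSet.pi S.countable_toSet fun i _ => ht i)]
  have : (fun ω : ℤ → ℝ => fun i => ω (e i)) ⁻¹' (Set.pi S t)
      = Set.pi (S.map e.toEmbedding : Finset ℤ) (fun j => t (e.symm j)) := by
    ext ω
    simp only [mem_preimage, Set.mem_pi, Finset.coe_map, mem_image, Finset.mem_coe]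
    constructor
    · rintro h _ ⟨i, hi, rfl⟩
      simpa using h i hi
    · intro h i hi
      simpa using h (e i) ⟨i, hi, rfl⟩
  rw [this, iid, Measure.infinitePi_pi _ fun i _ => ht _, Finset.prod_map]
  simp

lemma integral_tilted_comp_equiv (e : ℤ ≃ ℤ) {U f : (ℤ → ℝ) → ℝ} (hU : BddMeas U)
    (hf : BddMeas f) :
    ∫ ω, f (fun i => ω (e i)) ∂((iid ν).tilted fun ω => U (fun i => ω (e i)))
      = ∫ ω, f ω ∂((iid ν).tilted U) := by
  have key : ∀ {F : (ℤ → ℝ) → ℝ}, BddMeas F →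
      ∫ ω, F (fun i => ω (e i)) ∂(iid ν) = ∫ ω, F ω ∂(iid ν) := fun {F} hF => by
    conv_rhs => rw [← map_comp_equiv_iid ν e]
    rw [integral_map (measurable_comp_equiv e).aemeasurable hF.measurable.aestronglyMeasurable]
  rw [integral_tilted_eq_div, integral_tilted_eq_div, key hU.exp, key (hU.exp.mul hf)]

lemma ham_shift (A B a : ℤ) (ω : ℤ → ℝ) :
    ham Φ A B (fun i => ω (Equiv.addRight a i)) = ham Φ (A + a) (B + a) ω := by
  unfold ham crossE
  rw [← Finset.map_add_right_Ico, Finset.sum_map]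
  refine Finset.sum_congr rfl fun i _ => ?_
  rw [Finset.sum_map]
  refine Finset.sum_congr rfl fun j _ => ?_
  simp only [pairTerm, addRightEmbedding_apply, Equiv.coe_addRight]
  rw [← Finset.map_add_right_Icc, Finset.sum_map]
  congr 1
  congr 1
  ring

lemma integral_volGibbs_shift (hΦ : IsInteraction Φ b₀ s) (A B a : ℤ) {f : (ℤ → ℝ) → ℝ}
    (hf : BddMeas f) :
    ∫ ω, f (fun i => ω (i + a)) ∂(volGibbs ν Φ (A + a) (B + a)) = ∫ ω, f ω ∂(volGibbs ν Φ A B) := by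
  have := integral_tilted_comp_equiv ν (Equiv.addRight a) (bddMeas_ham hΦ A B) hf
  simp only [ham_shift] at this
  exact this

lemma sum_Ico_reflect (A B : ℤ) (f : ℤ → ℝ) :
    ∑ i ∈ Finset.Ico A B, f i = ∑ i ∈ Finset.Ico (-B) (-A), f (-1 - i) := by
  refine Finset.sum_bij' (fun i _ => -1 - i) (fun i _ => -1 - i) ?_ ?_ ?_ ?_ ?_
  · intro i hi; simp only [Finset.mem_Ico] at *; omega
  · intro i hi; simp only [Finset.mem_Ico] at *; omega
  · intro i _; ring
  · intro i _; ring
  · intro i _; congr 1; ring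

/-- The reflection `i ↦ -1 - i` sends the half-open `[A, B)` to the half-open `[-B, -A)`. It turns
estimates at the right end of the volume into estimates at the left end. -/
lemma ham_reflect (A B : ℤ) (ω : ℤ → ℝ) :
    ham Φ A B (fun i => ω (Equiv.subLeft (-1) i)) = ham Φ (-B) (-A) ω := by
  unfold ham crossE
  rw [Finset.sum_comm, sum_Ico_reflect]
  refine Finset.sum_congr rfl fun i _ => ?_
  rw [sum_Ico_reflect]
  refine Finset.sum_congr rfl fun j _ => ?_
  simp only [pairTerm, Equiv.subLeft_apply]
  congr 1
  · congr 1; ring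
  · refine Finset.sum_bij' (fun i _ => -1 - i) (fun i _ => -1 - i) ?_ ?_ ?_ ?_ ?_
    · intro i hi; simp only [Finset.mem_Icc] at *; omega
    · intro i hi; simp only [Finset.mem_Icc] at *; omega
    · intro i _; ring
    · intro i _; ring
    · intro i _; rfl

lemma integral_volGibbs_reflect (hΦ : IsInteraction Φ b₀ s) (A B : ℤ) {f : (ℤ → ℝ) → ℝ}
    (hf : BddMeas f) :
    ∫ ω, f (fun i => ω (-1 - i)) ∂(volGibbs ν Φ (-B) (-A)) = ∫ ω, f ω ∂(volGibbs ν Φ A B) := by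
  have := integral_tilted_comp_equiv ν (Equiv.subLeft (-1)) (bddMeas_ham hΦ A B) hf
  simp only [ham_reflect] at this
  exact this

/-! ### Dependence on the volume -/

lemma abs_integral_sub_integral_le {Ω : Type*} [MeasurableSpace Ω] (P P' : Measure Ω)
    [IsProbabilityMeasure P] [IsProbabilityMeasure P'] {F F' : Ω → ℝ} (hF : BddMeas F)
    (hF' : BddMeas F') {δ : ℝ} (h : ∀ x x', |F x - F' x'| ≤ δ) :
    |∫ x, F x ∂P - ∫ x, F' x ∂P'| ≤ δ := by
  have h1 : ∀ x', |∫ x, F x ∂P - F' x'| ≤ δ := fun x' => by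
    have := abs_integral_le_of_abs_le P (f := fun x => F x - F' x') (fun x => h x x')
    rw [integral_sub (hF.integrable P) (integrable_const _)] at this
    simpa using this
  have := abs_integral_le_of_abs_le P' (f := fun x' => ∫ x, F x ∂P - F' x') h1
  rw [integral_sub (integrable_const _) (hF'.integrable P')] at this
  simpa using this

lemma abs_integral_volGibbs_sub_right_le (hΦ : IsInteraction Φ b₀ s) {K κ : ℝ} {L : ℕ}
    (hK : CrossBound Φ K) (hκ : FarBound Φ L κ) (q : ℕ) {A b B B' : ℤ} (hAb : A ≤ b)
    (hB : b + q * L ≤ B) (hB' : b + q * L ≤ B') {f : (ℤ → ℝ) → ℝ} (hf : BddMeas f)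
    (hfb : DependsOn f (Iio b)) {D : ℝ} (hD : ∀ x y, |f x - f y| ≤ D) :
    |∫ ω, f ω ∂(volGibbs ν Φ A B) - ∫ ω, f ω ∂(volGibbs ν Φ A B')| ≤ oscRate K κ q * D := by
  have p1 := isProbabilityMeasure_volGibbs ν hΦ A B
  have p2 := isProbabilityMeasure_volGibbs ν hΦ A B'
  have e1 := integral_tilted_eq_integral_condE ν (Iio (b + q * L)) (bddMeas_ham hΦ A B) hf
  have e2 := integral_tilted_eq_integral_condE ν (Iio (b + q * L)) (bddMeas_ham hΦ A B') hf
  unfold volGibbs at *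
  rw [e1, e2]
  exact abs_integral_sub_integral_le _ _ (bddMeas_condE ν _ (bddMeas_ham hΦ A B) hf)
    (bddMeas_condE ν _ (bddMeas_ham hΦ A B') hf)
    fun x x' => abs_condE_sub_le ν hΦ hK hκ hAb hf hfb hD q B B' hB hB' x x'

lemma abs_integral_volGibbs_sub_left_le (hΦ : IsInteraction Φ b₀ s) {K κ : ℝ} {L : ℕ}
    (hK : CrossBound Φ K) (hκ : FarBound Φ L κ) (q : ℕ) {A A' a B : ℤ} (haB : a ≤ B)
    (hA : A ≤ a - q * L) (hA' : A' ≤ a - q * L) {f : (ℤ → ℝ) → ℝ} (hf : BddMeas f)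
    (hfa : DependsOn f (Ici a)) {D : ℝ} (hD : ∀ x y, |f x - f y| ≤ D) :
    |∫ ω, f ω ∂(volGibbs ν Φ A B) - ∫ ω, f ω ∂(volGibbs ν Φ A' B)| ≤ oscRate K κ q * D := by
  rw [← integral_volGibbs_reflect ν hΦ A B hf, ← integral_volGibbs_reflect ν hΦ A' B hf]
  have hm : Measurable fun ω : ℤ → ℝ => fun i => ω (-1 - i) :=
    measurable_pi_lambda _ fun i => measurable_pi_apply (-1 - i)
  refine abs_integral_volGibbs_sub_right_le ν hΦ hK hκ q (b := -a) (by omega) (by omega) (by omega)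
    (hf.comp hm) (fun x y h => hfa fun i hi => h _ ?_) (fun x y => hD _ _)
  simp only [mem_Ici, mem_Iio] at *
  omega

lemma abs_integral_volGibbs_sub_le (hΦ : IsInteraction Φ b₀ s) {K κ : ℝ} {L : ℕ}
    (hK : CrossBound Φ K) (hκ : FarBound Φ L κ) (q : ℕ) {A A' B B' a b : ℤ} (hab : a ≤ b)
    (hA : A ≤ a - q * L) (hA' : A' ≤ a - q * L)
    (hB : b + q * L ≤ B) (hB' : b + q * L ≤ B') {f : (ℤ → ℝ) → ℝ} (hf : BddMeas f)
    (hfb : DependsOn f (Ico a b)) {D : ℝ} (hD : ∀ x y, |f x - f y| ≤ D) :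
    |∫ ω, f ω ∂(volGibbs ν Φ A B) - ∫ ω, f ω ∂(volGibbs ν Φ A' B')|
      ≤ 2 * (oscRate K κ q * D) := by
  have hqL : (0 : ℤ) ≤ q * L := by positivity
  have h1 := abs_integral_volGibbs_sub_right_le ν hΦ hK hκ q (A := A) (by linarith) hB hB' hf
    (hfb.mono Ico_subset_Iio_self) hD
  have h2 := abs_integral_volGibbs_sub_left_le ν hΦ hK hκ q (B := B') (by linarith) hA hA' hf
    (hfb.mono Ico_subset_Ici_self) hD
  have := abs_sub_le (∫ ω, f ω ∂(volGibbs ν Φ A B)) (∫ ω, f ω ∂(volGibbs ν Φ A B'))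
    (∫ ω, f ω ∂(volGibbs ν Φ A' B'))
  linarith

/-- Order of choice: `q` makes the geometric term small, then `L` makes the far interaction small
against the fixed factor `exp (4K)`. -/
lemma exists_oscRate_le (hΦ : IsInteraction Φ b₀ s) (hb₀ : 0 ≤ b₀) (hs : 2 < s) {K : ℝ}
    (hK : 0 ≤ K) {ε : ℝ} (hε : 0 < ε) :
    ∃ (q L : ℕ) (κ : ℝ), FarBound Φ L κ ∧ oscRate K κ q ≤ ε := by
  have h1 : Tendsto (fun q : ℕ => (1 - Real.exp (-(4 * K))) ^ (q + 1)) atTop (𝓝 0) :=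
    (tendsto_pow_atTop_nhds_zero_of_lt_one
      (by rw [sub_nonneg]; exact Real.exp_le_one_iff.2 (by linarith))
      (by linarith [Real.exp_pos (-(4 * K))])).comp (tendsto_add_atTop_nat 1)
  obtain ⟨q, hq⟩ := (h1.eventually_lt_const (half_pos hε)).exists
  have h2 : Tendsto (fun L : ℕ => Real.exp (4 * K) *
      (1 - Real.exp (-(4 * (b₀ * decayConst s * (L : ℝ) ^ (2 - s)))))) atTop (𝓝 0) := by
    have h3 : Tendsto (fun L : ℕ => (L : ℝ) ^ (2 - s)) atTop (𝓝 0) := by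
      have := (tendsto_rpow_neg_atTop (show 0 < s - 2 by linarith)).comp
        (tendsto_natCast_atTop_atTop (R := ℝ))
      simpa [Function.comp_def] using this
    have hc : Continuous fun t : ℝ => Real.exp (4 * K) *
      (1 - Real.exp (-(4 * (b₀ * decayConst s * t)))) := by fun_prop
    have := (hc.tendsto 0).comp h3
    simpa [Function.comp_def] using this
  obtain ⟨L, hL, hL1⟩ := ((h2.eventually_lt_const (half_pos hε)).and (eventually_ge_atTop 1)).exists
  have hf := farBound hΦ hb₀ hs hL1
  refine ⟨q, L, _, hf, (oscRate_le hK hf.nonneg q).trans ?_⟩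
  linarith

/-- Expectations of local functions in large volumes depend little on the volume, uniformly in the
function. -/
lemma exists_radius (hΦ : IsInteraction Φ b₀ s) (hb₀ : 0 ≤ b₀) (hs : 2 < s) {ε : ℝ} (hε : 0 < ε) :
    ∃ R : ℕ, ∀ (a b : ℤ) (f : (ℤ → ℝ) → ℝ), a ≤ b → BddMeas f → DependsOn f (Ico a b) →
      (∀ x, |f x| ≤ 1) → ∀ A A' B B' : ℤ, A ≤ a - R → A' ≤ a - R → b + R ≤ B → b + R ≤ B' →
      |∫ ω, f ω ∂(volGibbs ν Φ A B) - ∫ ω, f ω ∂(volGibbs ν Φ A' B')| ≤ ε := by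
  have hK := crossBound hΦ hb₀ hs
  obtain ⟨q, L, κ, hκ, hle⟩ := exists_oscRate_le hΦ hb₀ hs hK.nonneg
    (show 0 < ε / 4 by linarith)
  refine ⟨q * L, fun a b f hab hf hfd hf1 A A' B B' hA hA' hB hB' => ?_⟩
  push_cast at *
  have := abs_integral_volGibbs_sub_le ν hΦ hK hκ q hab hA hA' hB hB' hf hfd (D := 2)
    (fun x y => (abs_sub _ _).trans (by linarith [hf1 x, hf1 y]))
  linarith

/-! ### Tightness -/

/-- Conditionally on the other coordinates the tilt is constant, so the `j`-th coordinate keeps the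
law `ν`. -/
lemma integral_site_tilted (j : ℤ) {V : (ℤ → ℝ) → ℝ} (hV : BddMeas V) (hVj : DependsOn V {j}ᶜ)
    {h : ℝ → ℝ} (hh : BddMeas h) :
    ∫ ω, h (ω j) ∂((iid ν).tilted V) = ∫ r, h r ∂ν := by
  have hp := isProbabilityMeasure_tilted_of_bddMeas (iid ν) hV
  have hm : BddMeas fun ω : ℤ → ℝ => h (ω j) := hh.comp (measurable_pi_apply j)
  rw [integral_tilted_eq_integral_condE ν {j} hV hm]
  have : ∀ x, condE ν {j} V (fun ω => h (ω j)) x = ∫ r, h r ∂ν := fun x => by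
    have h1 : ∀ ω, V (merge {j} ω x) = V x := fun ω => hVj fun i hi => merge_of_notMem hi
    have h2 : ∀ ω, merge {j} ω x j = ω j := fun ω => merge_of_mem rfl
    simp only [condE, h1, h2, tilted_const]
    have h3 := Measure.infinitePi_map_eval (fun _ : ℤ => ν) j
    conv_rhs => rw [← h3]
    rw [integral_map (measurable_pi_apply j).aemeasurable hh.measurable.aestronglyMeasurable]
    rfl
  simp only [this, integral_const, probReal_univ, one_smul]

/-- Cutting on both sides of `j` decouples this spacing and changes the energy by at most `2K`. The
domination by `ν` is uniform in site and volume, which serves both tightness and positivity. -/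
lemma volGibbs_site_le (hΦ : IsInteraction Φ b₀ s) {K : ℝ} (hK : CrossBound Φ K) (A B j : ℤ)
    {S : Set ℝ} (hS : MeasurableSet S) :
    volGibbs ν Φ A B {ω | ω j ∈ S} ≤ ENNReal.ofReal (Real.exp (4 * K)) * ν S := by
  have hK0 := hK.nonneg
  obtain ⟨V, hV, hVj, hVd⟩ : ∃ V, BddMeas V ∧ DependsOn V {j}ᶜ ∧
      ∀ ω, |V ω - ham Φ A B ω - 0| ≤ 2 * K := by
    by_cases hj : A ≤ j ∧ j < B
    · refine ⟨fun ω => ham Φ A j ω + ham Φ (j + 1) B ω,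
        (bddMeas_ham hΦ _ _).add (bddMeas_ham hΦ _ _), fun x y h => ?_, fun ω => ?_⟩
      · have h1 : ham Φ A j x = ham Φ A j y :=
          ham_dependsOn Φ _ _ fun i hi => h i (by simp only [mem_Ico] at hi; simp; omega)
        have h2 : ham Φ (j + 1) B x = ham Φ (j + 1) B y :=
          ham_dependsOn Φ _ _ fun i hi => h i (by simp only [mem_Ico] at hi; simp; omega)
        simp only [h1, h2]
      · rw [ham_split hΦ hj.1 hj.2.le, ham_split hΦ (show j ≤ j + 1 by omega)
          (show j + 1 ≤ B by omega)]
        have e : ham Φ j (j + 1) ω = 0 := by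
          unfold ham crossE
          refine Finset.sum_eq_zero fun i hi => Finset.sum_eq_zero fun l hl =>
            pairTerm_eq_zero hΦ ?_ ω
          simp only [Finset.mem_Ico] at hi hl
          omega
        have k1 := abs_le.1 (hK A j B ω)
        have k2 := abs_le.1 (hK j (j + 1) B ω)
        rw [e, abs_le]
        constructor <;> linarith [k1.1, k1.2, k2.1, k2.2]
    · refine ⟨ham Φ A B, bddMeas_ham hΦ _ _, (ham_dependsOn Φ A B).mono fun i hi => ?_,
        fun ω => ?_⟩
      · simp only [mem_Ico, mem_compl_iff, mem_singleton_iff] at *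
        rintro rfl
        exact hj hi
      · simp only [sub_self, abs_zero]; positivity
  have hp := isProbabilityMeasure_volGibbs ν hΦ A B
  have hi : BddMeas (S.indicator fun _ => (1 : ℝ)) := BddMeas.indicator hS
  have key := exp_mul_integral_tilted_le (iid ν) hV (bddMeas_ham hΦ A B)
    (hi.comp (measurable_pi_apply j)) (fun x => indicator_nonneg (fun _ _ => zero_le_one) _) hVd
  rw [integral_site_tilted ν j hV hVj hi] at key
  have e1 : ∫ ω, S.indicator (fun _ => (1 : ℝ)) (ω j) ∂((iid ν).tilted (ham Φ A B))
      = (volGibbs ν Φ A B).real {ω | ω j ∈ S} := by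
    have hm : MeasurableSet {ω : ℤ → ℝ | ω j ∈ S} := measurable_pi_apply j hS
    rw [← integral_indicator_one hm]
    rfl
  have e2 : ∫ r, S.indicator (fun _ => (1 : ℝ)) r ∂ν = ν.real S := integral_indicator_one hS
  rw [e1, e2] at key
  have key2 : (volGibbs ν Φ A B).real {ω | ω j ∈ S} ≤ Real.exp (4 * K) * ν.real S := by
    have h0 : Real.exp (4 * K) * Real.exp (-(2 * (2 * K))) = 1 := by
      rw [← Real.exp_add]; ring_nf; simp
    calc _ = Real.exp (4 * K) * (Real.exp (-(2 * (2 * K))) *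
          (volGibbs ν Φ A B).real {ω | ω j ∈ S}) := by rw [← mul_assoc, h0, one_mul]
      _ ≤ _ := by gcongr
  rw [← ofReal_measureReal (measure_ne_top _ _), ← ofReal_measureReal (measure_ne_top ν S),
    ← ENNReal.ofReal_mul (Real.exp_pos _).le]
  exact ENNReal.ofReal_le_ofReal key2

/-- The Gibbs measure of `[-N, N)` as a probability measure. -/
def volGibbsProb (hΦ : IsInteraction Φ b₀ s) (N : ℕ) : ProbabilityMeasure (ℤ → ℝ) :=
  ⟨volGibbs ν Φ (-N) N, isProbabilityMeasure_volGibbs ν hΦ _ _⟩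

/-- A product of compact sets is compact, and a union bound with summable errors `δ j` controls its
complement, since every marginal is dominated by `c * ν`. -/
lemma isTight_volGibbsProb (hΦ : IsInteraction Φ b₀ s) {K : ℝ} (hK : CrossBound Φ K) :
    IsTightMeasureSet {((μ : ProbabilityMeasure (ℤ → ℝ)) : Measure (ℤ → ℝ)) |
      μ ∈ range (volGibbsProb ν hΦ)} := by
  rw [isTightMeasureSet_iff_exists_isCompact_measure_compl_le]
  intro ε hε
  obtain ⟨δ, hδ, hsum⟩ := ENNReal.exists_pos_sum_of_countable' hε.ne' ℤ
  set c := ENNReal.ofReal (Real.exp (4 * K)) with hc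
  have hc0 : c ≠ 0 := by simp [hc, Real.exp_pos]
  have hct : c ≠ ⊤ := ENNReal.ofReal_ne_top
  have hν : IsTightMeasureSet ({ν} : Set (Measure ℝ)) := isTightMeasureSet_singleton
  rw [isTightMeasureSet_iff_exists_isCompact_measure_compl_le] at hν
  choose Kc hKc hKν using fun j : ℤ => hν (δ j / c) (ENNReal.div_pos (hδ j).ne' hct)
  refine ⟨Set.pi univ Kc, isCompact_univ_pi hKc, ?_⟩
  rintro _ ⟨_, ⟨N, rfl⟩, rfl⟩
  have hsub : (Set.pi univ Kc)ᶜ ⊆ ⋃ j : ℤ, {ω : ℤ → ℝ | ω j ∈ (Kc j)ᶜ} := by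
    intro ω hω
    simpa [Set.mem_pi] using hω
  calc volGibbs ν Φ (-N) N (Set.pi univ Kc)ᶜ
      ≤ ∑' j, volGibbs ν Φ (-N) N {ω : ℤ → ℝ | ω j ∈ (Kc j)ᶜ} :=
        (measure_mono hsub).trans (measure_iUnion_le _)
    _ ≤ ∑' j, δ j := by
        refine ENNReal.tsum_le_tsum fun j => ?_
        refine (volGibbs_site_le ν hΦ hK _ _ j (hKc j).measurableSet.compl).trans ?_
        calc c * ν (Kc j)ᶜ ≤ c * (δ j / c) := by gcongr; exact hKν j ν rfl
          _ = δ j := ENNReal.mul_div_cancel hc0 hct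
    _ ≤ ε := hsum.le

/-! ### The infinite-volume limit -/

lemma window_eqOn {k : ℕ} {a : ℤ} {x y : ℤ → ℝ} (h : ∀ i ∈ Ico a (a + k), x i = y i) :
    window k a x = window k a y := by
  ext l
  exact h _ (by have := l.2; simp only [mem_Ico]; omega)

lemma measurable_window (k : ℕ) (a : ℤ) : Measurable (window k a) :=
  measurable_pi_lambda _ fun _ => measurable_pi_apply _

lemma continuous_window (k : ℕ) (a : ℤ) : Continuous (window k a) :=
  continuous_pi fun _ => continuous_apply _

/-- `μ` is the limit of the Gibbs measures in large volumes, uniformly in the local functions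
bounded by `1`. -/
def IsVolLimit (ν : Measure ℝ) [IsProbabilityMeasure ν] (Φ : ℕ → ℝ → ℝ)
    (μ : Measure (ℤ → ℝ)) : Prop :=
  ∀ ε : ℝ, 0 < ε → ∃ R : ℕ, ∀ (k : ℕ) (a : ℤ) (h : (Fin k → ℝ) → ℝ), BddMeas h →
    (∀ x, |h x| ≤ 1) → ∀ A B : ℤ, A ≤ a - R → a + k + R ≤ B →
    |∫ ω, h (window k a ω) ∂(volGibbs ν Φ A B) - ∫ ω, h (window k a ω) ∂μ| ≤ ε

/-- Tightness gives a limit point along an ultrafilter. The uniform comparison of volumes in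
`exists_radius` upgrades it to a limit over all volumes, and approximation in `L¹` passes from
continuous to measurable local functions. -/
lemma exists_bulk (hΦ : IsInteraction Φ b₀ s) (hb₀ : 0 ≤ b₀) (hs : 2 < s) :
    ∃ μ : Measure (ℤ → ℝ), IsProbabilityMeasure μ ∧ IsVolLimit ν Φ μ := by
  have hcpt := isCompact_closure_of_isTightMeasureSet
    (isTight_volGibbsProb ν hΦ (crossBound hΦ hb₀ hs))
  obtain ⟨μ, -, hμ⟩ := hcpt.ultrafilter_le_nhds ((hyperfilter ℕ).map (volGibbsProb ν hΦ)) (by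
    rw [le_principal_iff]
    exact Ultrafilter.mem_map.2 (univ_mem' fun N => subset_closure ⟨N, rfl⟩))
  have hlim : Tendsto (volGibbsProb ν hΦ) (hyperfilter ℕ : Filter ℕ) (𝓝 μ) := hμ
  rw [ProbabilityMeasure.tendsto_iff_forall_integral_tendsto] at hlim
  refine ⟨μ, inferInstance, fun ε hε => ?_⟩
  obtain ⟨R, hR⟩ := exists_radius ν hΦ hb₀ hs hε
  refine ⟨R, fun k a h hh hh1 A B hA hB => ?_⟩
  have hQ := isProbabilityMeasure_volGibbs ν hΦ A B
  set Q := volGibbs ν Φ A B with hQdef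
  have hw := measurable_window k a
  have hcont : ∀ g : BoundedContinuousFunction (Fin k → ℝ) ℝ, (∀ x, |g x| ≤ 1) →
      |∫ ω, g (window k a ω) ∂Q - ∫ ω, g (window k a ω) ∂(μ : Measure (ℤ → ℝ))| ≤ ε := by
    intro g hg
    have ht := hlim (g.compContinuous ⟨window k a, continuous_window k a⟩)
    simp only [BoundedContinuousFunction.compContinuous_apply, ContinuousMap.coe_mk] at ht
    refine le_of_tendsto ((tendsto_const_nhds.sub ht).abs) ?_
    have hN : ∀ᶠ N : ℕ in (hyperfilter ℕ : Filter ℕ), (a - R).natAbs + (a + k + R).natAbs ≤ N :=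
      Nat.hyperfilter_le_atTop (eventually_ge_atTop _)
    filter_upwards [hN] with N hN
    refine hR a (a + k) (fun ω => g (window k a ω)) (by omega) ?_
      (fun x y hxy => by simp only [window_eqOn hxy]) (fun x => hg _) A (-N) B N hA (by omega) hB (by omega)
    exact BddMeas.comp ⟨g.continuous.measurable, 1, hg⟩ hw
  refine le_of_forall_pos_le_add fun δ hδ => ?_
  -- One continuous function must approximate `h` under both laws, hence their sum.
  set σ := Q.map (window k a) + (μ : Measure (ℤ → ℝ)).map (window k a) with hσ
  have i1 : IsProbabilityMeasure (Q.map (window k a)) :=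
    Measure.isProbabilityMeasure_map hw.aemeasurable
  have i2 : IsProbabilityMeasure ((μ : Measure (ℤ → ℝ)).map (window k a)) :=
    Measure.isProbabilityMeasure_map hw.aemeasurable
  obtain ⟨g₀, hg₀, -⟩ := (hh.integrable σ).exists_boundedContinuous_integral_sub_le hδ
  -- Clipping to `[-1, 1]` makes `hcont` applicable and does not increase the distance to `h`.
  let g : BoundedContinuousFunction (Fin k → ℝ) ℝ :=
    BoundedContinuousFunction.ofNormedAddCommGroup (fun x => max (-1) (min 1 (g₀ x)))
      (by fun_prop) 1 (fun x => by
        rw [Real.norm_eq_abs, abs_le]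
        exact ⟨le_max_left _ _, max_le (by norm_num) (min_le_left _ _)⟩)
  have hg1 : ∀ x, |g x| ≤ 1 := fun x => by
    rw [abs_le]
    exact ⟨le_max_left _ _, max_le (by norm_num) (min_le_left _ _)⟩
  have hgb : BddMeas g := ⟨g.continuous.measurable, 1, hg1⟩
  have hgh : ∀ x, |h x - g x| ≤ ‖h x - g₀ x‖ := fun x => by
    have h1 := abs_le.1 (hh1 x)
    change |h x - max (-1) (min 1 (g₀ x))| ≤ |h x - g₀ x|
    rcases max_cases (-1) (min 1 (g₀ x)) with ⟨e1, e2⟩ | ⟨e1, e2⟩ <;>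
    rcases min_cases 1 (g₀ x) with ⟨e3, e4⟩ | ⟨e3, e4⟩ <;>
    rw [e1] <;> (try rw [e3]) <;>
    rcases abs_cases (h x - g₀ x) with ⟨e5, e6⟩ | ⟨e5, e6⟩ <;>
    rw [e5, abs_le] <;> constructor <;> linarith
  have hd : BddMeas fun x => h x - g x := hh.sub hgb
  have hInt : ∫ x, |h x - g x| ∂σ ≤ δ := by
    refine le_trans (integral_mono (hd.integrable σ).abs ?_ hgh) hg₀
    exact ((hh.integrable σ).sub (g₀.integrable σ)).norm
  rw [hσ, integral_add_measure (hd.integrable _).abs (hd.integrable _).abs,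
    integral_map hw.aemeasurable hd.measurable.abs.aestronglyMeasurable,
    integral_map hw.aemeasurable hd.measurable.abs.aestronglyMeasurable] at hInt
  have e1 : ∀ P : Measure (ℤ → ℝ), IsProbabilityMeasure P →
      |∫ ω, h (window k a ω) ∂P - ∫ ω, g (window k a ω) ∂P|
        ≤ ∫ ω, |h (window k a ω) - g (window k a ω)| ∂P := fun P _ => by
    rw [← integral_sub ((hh.comp hw).integrable P) ((hgb.comp hw).integrable P)]
    exact abs_integral_le_integral_abs
  have a1 := abs_le.1 (e1 Q hQ)
  have a2 := abs_le.1 (e1 μ inferInstance)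
  have a3 := abs_le.1 (hcont g hg1)
  rw [abs_le]
  constructor <;> linarith [a1.1, a1.2, a2.1, a2.2, a3.1, a3.2]

end

/-! ### Products and tilts -/

/-- Both the density and its normalisation factorise over the coordinates. -/
lemma pi_tilted (μ₀ : Measure ℝ) [SigmaFinite μ₀] {g : ℝ → ℝ}
    [IsProbabilityMeasure (μ₀.tilted g)] (M : ℕ) :
    (Measure.pi fun _ : Fin M => μ₀.tilted g)
      = (Measure.pi fun _ : Fin M => μ₀).tilted fun z => ∑ i, g (z i) := by
  refine Measure.pi_eq fun t ht => ?_
  rw [tilted_apply_eq_ofReal_integral]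
  have h1 : ∫ z : Fin M → ℝ, Real.exp (∑ i, g (z i)) ∂(Measure.pi fun _ => μ₀)
      = ∏ _i : Fin M, ∫ x, Real.exp (g x) ∂μ₀ := by
    simp_rw [Real.exp_sum]
    exact integral_fintype_prod_eq_prod (fun _ x => Real.exp (g x))
  have h2 : ∀ z : Fin M → ℝ, Real.exp (∑ i, g (z i))
      / ∫ z : Fin M → ℝ, Real.exp (∑ i, g (z i)) ∂(Measure.pi fun _ => μ₀)
      = ∏ i, (Real.exp (g (z i)) / ∫ x, Real.exp (g x) ∂μ₀) := fun z => by
    rw [h1, Finset.prod_div_distrib, Real.exp_sum]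
  simp_rw [h2]
  rw [Measure.restrict_pi_pi, integral_fintype_prod_eq_prod
    (fun _ x => Real.exp (g x) / ∫ x, Real.exp (g x) ∂μ₀), ENNReal.ofReal_prod_of_nonneg]
  · simp_rw [tilted_apply_eq_ofReal_integral]
  · intro i _
    exact integral_nonneg fun x => div_nonneg (Real.exp_pos _).le
      (integral_nonneg fun y => (Real.exp_pos _).le)

lemma integrable_exp_sum (μ₀ : Measure ℝ) [SigmaFinite μ₀] {g : ℝ → ℝ}
    (hg : Integrable (fun x => Real.exp (g x)) μ₀) (M : ℕ) :
    Integrable (fun z : Fin M → ℝ => Real.exp (∑ i, g (z i))) (Measure.pi fun _ => μ₀) := by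
  simp_rw [Real.exp_sum]
  exact Integrable.fintype_prod (f := fun _ x => Real.exp (g x)) fun _ => hg

lemma inv_smul_withDensity_exp {Ω : Type*} [MeasurableSpace Ω] (μ : Measure Ω) {U : Ω → ℝ}
    (hU : Integrable (fun x => Real.exp (U x)) μ) :
    ((μ.withDensity fun x => ENNReal.ofReal (Real.exp (U x))) univ)⁻¹ •
      (μ.withDensity fun x => ENNReal.ofReal (Real.exp (U x))) = μ.tilted U := by
  rcases eq_zero_or_neZero μ with rfl | h0
  · simp
  have hpos := integral_exp_pos hU
  rw [withDensity_apply _ MeasurableSet.univ, setLIntegral_univ,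
    ← ofReal_integral_eq_lintegral_ofReal hU (ae_of_all _ fun _ => (Real.exp_pos _).le),
    Measure.tilted, ← withDensity_smul' _ _ (by simp [hpos])]
  congr 1 with x
  rw [Pi.smul_apply, smul_eq_mul, ENNReal.ofReal_div_of_pos hpos, div_eq_mul_inv, mul_comm]

/-! ### Sums in the extended reals -/

lemma ereal_coe_sum {ι : Type*} (S : Finset ι) (f : ι → ℝ) :
    ((∑ i ∈ S, f i : ℝ) : EReal) = ∑ i ∈ S, (f i : EReal) := by
  classical
  induction S using Finset.induction_on with
  | empty => simp
  | insert a S ha ih => rw [Finset.sum_insert ha, Finset.sum_insert ha, EReal.coe_add, ih]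

lemma ereal_sum_ne_bot {ι : Type*} (S : Finset ι) {f : ι → EReal} (h : ∀ i ∈ S, f i ≠ ⊥) :
    ∑ i ∈ S, f i ≠ ⊥ := by
  classical
  induction S using Finset.induction_on with
  | empty => simp
  | insert a S ha ih =>
    rw [Finset.sum_insert ha, EReal.add_ne_bot_iff]
    exact ⟨h a (by simp), ih fun i hi => h i (by simp [hi])⟩

lemma ereal_sum_eq_top {ι : Type*} (S : Finset ι) {f : ι → EReal} (h : ∀ i ∈ S, f i ≠ ⊥) {i : ι}
    (hi : i ∈ S) (hf : f i = ⊤) : ∑ i ∈ S, f i = ⊤ := by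
  classical
  rw [← Finset.add_sum_erase S f hi, hf]
  exact EReal.top_add_of_ne_bot (ereal_sum_ne_bot _ fun j hj => h j (Finset.mem_of_mem_erase hj))

/-! ### The pair potential -/

section Potential

variable {v : ℝ → EReal} {rhc zmin zmax α₁ α₂ s : ℝ}

lemma IsLennardJonesType.coe_realPart (hv : IsLennardJonesType v rhc zmin zmax α₁ α₂ s) {r : ℝ}
    (hr : rhc < r) : (realPart v r : EReal) = v r :=
  EReal.coe_toReal (hv.ne_top r hr) (hv.ne_bot r hr)

lemma IsLennardJonesType.ne_bot_of_pos (hv : IsLennardJonesType v rhc zmin zmax α₁ α₂ s) {r : ℝ}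
    (hr : 0 < r) : v r ≠ ⊥ := fun h => by
  have := hv.lower_bound r hr
  rw [h] at this
  exact absurd (le_bot_iff.1 this) (EReal.coe_ne_bot _)

lemma IsLennardJonesType.rhc_lt_zmax (hv : IsLennardJonesType v rhc zmin zmax α₁ α₂ s) :
    rhc < zmax := hv.rhc_lt_zmin.trans hv.zmin_lt_zmax

lemma IsLennardJonesType.realPart_zmax_le (hv : IsLennardJonesType v rhc zmin zmax α₁ α₂ s)
    {r : ℝ} (hr : rhc < r) : realPart v zmax ≤ realPart v r := by
  rw [← EReal.coe_le_coe_iff, hv.coe_realPart hr, hv.coe_realPart hv.rhc_lt_zmax]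
  by_cases h : r = zmax
  · rw [h]
  · exact (hv.unique_min r (hv.rhc_nonneg.trans_lt hr) h).le

/-- The interaction through `n ≥ 2` spacings decays like `n ^ (-s)` uniformly. -/
lemma IsLennardJonesType.exists_abs_realPart_le
    (hv : IsLennardJonesType v rhc zmin zmax α₁ α₂ s) (hrhc : 0 < rhc) :
    ∃ b : ℝ, 0 < b ∧ ∀ (n : ℕ) (r : ℝ), 2 ≤ n → n * rhc < r →
      |realPart v r| ≤ b * (n : ℝ) ^ (-s) := by
  have hs : 0 < s := by linarith [hv.two_lt_s]
  have hz0 : 0 < zmax := hrhc.trans hv.rhc_lt_zmax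
  set V := |realPart v (2 * rhc)| + |realPart v zmax| with hV
  have hV0 : 0 ≤ V := by positivity
  refine ⟨α₁ * rhc ^ (-s) + V * (zmax / rhc) ^ s, ?_, fun n r hn hr => ?_⟩
  · have := hv.α₁_pos
    positivity
  have hn' : (2 : ℝ) ≤ n := by exact_mod_cast hn
  have hn0 : (0 : ℝ) < n := by linarith
  have h2r : 2 * rhc < r := lt_of_le_of_lt (by gcongr) hr
  have hr1 : rhc < r := by linarith
  have hr0 : 0 < r := hrhc.trans hr1
  have hnn : 0 ≤ (n : ℝ) ^ (-s) := by positivity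
  -- Beyond `zmax` the potential is nonpositive and its lower bound decays. Up to `zmax`, it lies
  -- between its minimum and its value at `2 * rhc`, and `n * rhc < zmax` makes `(zmax / (n * rhc))
  -- ^ s` at least `1`.
  rcases lt_or_ge zmax r with hzr | hzr
  · have hle : realPart v r ≤ 0 := by
      rw [← EReal.coe_le_coe_iff, hv.coe_realPart hr1]
      exact_mod_cast hv.nonpos r hzr
    have hge : -α₁ * r ^ (-s) ≤ realPart v r := by
      rw [← EReal.coe_le_coe_iff, hv.coe_realPart hr1]
      exact hv.lower_bound r hr0
    have hpow : r ^ (-s) ≤ (n * rhc) ^ (-s) :=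
      Real.rpow_le_rpow_of_nonpos (by positivity) hr.le (by linarith)
    rw [Real.mul_rpow hn0.le hrhc.le] at hpow
    rw [abs_of_nonpos hle]
    have h1 : 0 ≤ V * (zmax / rhc) ^ s * (n : ℝ) ^ (-s) := by positivity
    have h2 := mul_le_mul_of_nonneg_left hpow hv.α₁_pos.le
    nlinarith
  · have hVr : |realPart v r| ≤ V := by
      have h1 : realPart v zmax ≤ realPart v r := hv.realPart_zmax_le hr1
      have h2 : realPart v r ≤ realPart v (2 * rhc) := by
        rw [← EReal.coe_le_coe_iff, hv.coe_realPart hr1,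
          hv.coe_realPart (show rhc < 2 * rhc by linarith)]
        rcases eq_or_lt_of_le hzr with h | h
        · rw [h]
          exact (hv.unique_min _ (by linarith) (by linarith)).le
        · exact hv.antitoneOn ⟨by linarith, by linarith⟩ ⟨hr0, h⟩ h2r.le
      rw [abs_le]
      have a1 := neg_abs_le (realPart v zmax)
      have a2 := le_abs_self (realPart v (2 * rhc))
      have a3 := abs_nonneg (realPart v zmax)
      have a4 := abs_nonneg (realPart v (2 * rhc))
      constructor <;> rw [hV] <;> linarith
    have h1 : 1 ≤ (zmax / rhc) ^ s * (n : ℝ) ^ (-s) := by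
      rw [Real.rpow_neg hn0.le, ← div_eq_mul_inv, ← Real.div_rpow (by positivity) hn0.le]
      refine Real.one_le_rpow ?_ hs.le
      rw [le_div_iff₀ hn0, le_div_iff₀ hrhc]
      linarith
    have h2 : 0 ≤ α₁ * rhc ^ (-s) * (n : ℝ) ^ (-s) := by
      have := hv.α₁_pos
      positivity
    have h3 := mul_le_mul_of_nonneg_left h1 hV0
    nlinarith

open Classical in
/-- The Boltzmann factor exponent of the interaction through `n ≥ 2` spacings. -/
def chainInteraction (v : ℝ → EReal) (rhc : ℝ) (m : ℕ∞) (β : ℝ) (n : ℕ) (r : ℝ) : ℝ :=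
  if 2 ≤ n ∧ (n : ℕ∞) ≤ m ∧ n * rhc < r then -(β * realPart v r) else 0

lemma IsLennardJonesType.isInteraction (hv : IsLennardJonesType v rhc zmin zmax α₁ α₂ s)
    (hrhc : 0 < rhc) (m : ℕ∞) {β b : ℝ} (hβ : 0 < β) (hb0 : 0 < b)
    (hb : ∀ (n : ℕ) (r : ℝ), 2 ≤ n → n * rhc < r → |realPart v r| ≤ b * (n : ℝ) ^ (-s)) :
    IsInteraction (chainInteraction v rhc m β) (β * b) s where
  measurable n := by
    by_cases h : 2 ≤ n ∧ (n : ℕ∞) ≤ m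
    · have hn : (2 : ℝ) ≤ n := by exact_mod_cast h.1
      have : chainInteraction v rhc m β n
          = fun r => if (n : ℝ) * rhc < r then -(β * realPart v r) else 0 := by
        ext r
        simp [chainInteraction, h]
      rw [this]
      -- Regularity of `v` is known only beyond the hard core, so measurability is checked
      -- piecewise.
      refine measurable_of_restrict_of_restrict_compl (s := Ioi ((n : ℝ) * rhc))
        measurableSet_Ioi ?_ ?_
      · have hc : ContinuousOn (fun r => if (n : ℝ) * rhc < r then -(β * realPart v r) else 0)
            (Ioi ((n : ℝ) * rhc)) := by
          refine ((continuousOn_const.mul (hv.contDiffOn.continuousOn.mono ?_)).neg).congr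
            (f := fun r => -(β * realPart v r)) ?_
          · exact Ioi_subset_Ioi (by nlinarith)
          · intro r hr
            simp only [mem_Ioi] at hr
            simp [hr]
        exact (continuousOn_iff_continuous_domRestrict.1 hc).measurable
      · have hc : ContinuousOn (fun r => if (n : ℝ) * rhc < r then -(β * realPart v r) else 0)
            (Ioi ((n : ℝ) * rhc))ᶜ := by
          refine (continuousOn_const (c := (0 : ℝ))).congr ?_
          intro r hr
          simp only [mem_compl_iff, mem_Ioi] at hr
          simp [hr]
        exact (continuousOn_iff_continuous_domRestrict.1 hc).measurable
    · have : chainInteraction v rhc m β n = fun _ => 0 := by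
        ext r
        rw [chainInteraction, if_neg]
        exact fun h' => h ⟨h'.1, h'.2.1⟩
      rw [this]
      exact measurable_const
  eq_zero_of_le_one n r hn := by
    rw [chainInteraction, if_neg]
    omega
  abs_le n r := by
    by_cases h : 2 ≤ n ∧ (n : ℕ∞) ≤ m ∧ n * rhc < r
    · rw [chainInteraction, if_pos h, abs_neg, abs_mul, abs_of_pos hβ, mul_assoc]
      exact mul_le_mul_of_nonneg_left (hb n r h.1 h.2.2) hβ.le
    · rw [chainInteraction, if_neg h, abs_zero]
      positivity

/-- The law of a single spacing. -/
def siteMeasure (v : ℝ → EReal) (rhc β p : ℝ) : Measure ℝ :=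
  (volume.restrict (Ioi rhc)).tilted fun z => -(β * (realPart v z + p * z))

/-- The potential is bounded below by its minimum, and the pressure supplies exponential decay. -/
lemma IsLennardJonesType.integrable_exp_site (hv : IsLennardJonesType v rhc zmin zmax α₁ α₂ s)
    {β p : ℝ} (hβ : 0 < β) (hp : 0 < p) :
    Integrable (fun z => Real.exp (-(β * (realPart v z + p * z)))) (volume.restrict (Ioi rhc)) := by
  have h1 := (exp_neg_integrableOn_Ioi rhc (mul_pos hβ hp)).const_mul
    (Real.exp (-(β * realPart v zmax)))
  refine Integrable.mono' h1 ?_ ?_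
  · refine ContinuousOn.aestronglyMeasurable ?_ measurableSet_Ioi
    have := hv.contDiffOn.continuousOn
    fun_prop
  · refine (ae_restrict_iff' measurableSet_Ioi).2 (ae_of_all _ fun z hz => ?_)
    rw [Real.norm_eq_abs, Real.abs_exp, ← Real.exp_add]
    refine Real.exp_le_exp.2 ?_
    have := mul_le_mul_of_nonneg_left (hv.realPart_zmax_le hz) hβ.le
    nlinarith

lemma IsLennardJonesType.isProbabilityMeasure_siteMeasure
    (hv : IsLennardJonesType v rhc zmin zmax α₁ α₂ s) {β p : ℝ} (hβ : 0 < β) (hp : 0 < p) :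
    IsProbabilityMeasure (siteMeasure v rhc β p) := by
  have : NeZero ((volume : Measure ℝ).restrict (Ioi rhc)) := ⟨by simp⟩
  exact isProbabilityMeasure_tilted (hv.integrable_exp_site hβ hp)

lemma siteMeasure_ae (v : ℝ → EReal) (rhc β p : ℝ) : ∀ᵐ z ∂(siteMeasure v rhc β p), rhc < z :=
  (tilted_absolutelyContinuous _ _).ae_le (ae_restrict_mem measurableSet_Ioi)

end Potential

/-! ### The finite chain as a tilted product measure. -/

section

/-- The total interaction of a chain of `M` spacings. -/
def chainHam (Φ : ℕ → ℝ → ℝ) {M : ℕ} (z : Fin M → ℝ) : ℝ :=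
  ∑ i : Fin M, ∑ j : Fin M, Φ ((j : ℕ) + 1 - i) (∑ l ∈ Finset.Icc i j, z l)

lemma sum_Ico_zero_eq_sum_fin (M : ℕ) (f : ℤ → ℝ) :
    ∑ i ∈ Finset.Ico (0 : ℤ) M, f i = ∑ i : Fin M, f (i : ℕ) := by
  rw [Fin.sum_univ_eq_sum_range (fun i : ℕ => f (i : ℤ)) M]
  refine Finset.sum_bij' (fun i _ => i.toNat) (fun i _ => (i : ℤ)) ?_ ?_ ?_ ?_ ?_
  · intro i hi; simp only [Finset.mem_Ico, Finset.mem_range] at *; omega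
  · intro i hi; simp only [Finset.mem_Ico, Finset.mem_range] at *; omega
  · intro i hi; simp only [Finset.mem_Ico] at *; omega
  · intro i hi; simp
  · intro i hi
    simp only [Finset.mem_Ico] at hi
    rw [Int.toNat_of_nonneg hi.1]

lemma ham_eq_chainHam (Φ : ℕ → ℝ → ℝ) (M : ℕ) (ω : ℤ → ℝ) :
    ham Φ 0 M ω = chainHam Φ (window M 0 ω) := by
  unfold ham crossE chainHam
  rw [sum_Ico_zero_eq_sum_fin]
  refine Finset.sum_congr rfl fun i _ => ?_
  rw [sum_Ico_zero_eq_sum_fin]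
  refine Finset.sum_congr rfl fun j _ => ?_
  rw [pairTerm]
  congr 1
  · omega
  · refine Finset.sum_bij' (fun l hl => ⟨l.toNat, ?_⟩) (fun l _ => ((l : ℕ) : ℤ)) ?_ ?_ ?_ ?_ ?_
    · simp only [Finset.mem_Icc] at hl; omega
    · intro l hl
      have hl' := Finset.mem_Icc.1 hl
      simp only [Finset.mem_Icc, Fin.le_def]
      omega
    · intro l hl
      have hl' := Finset.mem_Icc.1 hl
      simp only [Fin.le_def] at hl'
      simp only [Finset.mem_Icc]
      omega
    · intro l hl
      have hl' := Finset.mem_Icc.1 hl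
      simp only
      omega
    · intro l hl
      simp
    · intro l hl
      simp only [Finset.mem_Icc] at hl
      simp only [window]
      congr 1
      omega

lemma bddMeas_chainHam {Φ : ℕ → ℝ → ℝ} {b₀ s : ℝ} (hΦ : IsInteraction Φ b₀ s) (M : ℕ) :
    BddMeas (chainHam Φ : (Fin M → ℝ) → ℝ) := by
  unfold chainHam
  refine BddMeas.sum _ fun i _ => BddMeas.sum _ fun j _ => ⟨?_, _, fun z => hΦ.abs_le _ _⟩
  exact (hΦ.measurable _).comp (Finset.measurable_sum _ fun l _ => measurable_pi_apply l)

lemma map_window_iid (ν : Measure ℝ) [IsProbabilityMeasure ν] (M : ℕ) :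
    (iid ν).map (window M 0) = Measure.pi fun _ : Fin M => ν := by
  symm
  refine Measure.pi_eq fun t ht => ?_
  rw [Measure.map_apply (measurable_window M 0) (MeasurableSet.univ_pi ht)]
  classical
  let e : Fin M ↪ ℤ := ⟨fun l => ((l : ℕ) : ℤ), fun a b h => Fin.ext (by simpa using h)⟩
  let t' : ℤ → Set ℝ := fun i => if h : 0 ≤ i ∧ i < M then t ⟨i.toNat, by omega⟩ else univ
  have he : ∀ l : Fin M, e l = ((l : ℕ) : ℤ) := fun _ => rfl
  have ht' : ∀ l : Fin M, t' (e l) = t l := fun l => by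
    have : (0 : ℤ) ≤ ((l : ℕ) : ℤ) ∧ ((l : ℕ) : ℤ) < M := by omega
    simp only [t', he]
    rw [dif_pos this]
    congr 1
  have hm : ∀ i, MeasurableSet (t' i) := fun i => by
    simp only [t']
    split_ifs
    · exact ht _
    · exact MeasurableSet.univ
  have : window M 0 ⁻¹' (Set.pi univ t) = Set.pi ((Finset.univ.map e : Finset ℤ) : Set ℤ) t' := by
    ext ω
    simp only [mem_preimage, Set.mem_pi, mem_univ, true_imp_iff, Finset.coe_map, mem_image,
      Finset.coe_univ, forall_exists_index, true_and]
    constructor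
    · rintro h _ l rfl
      rw [ht']
      simpa [window, he] using h l
    · intro h l
      have := h _ l rfl
      rw [ht'] at this
      simpa [window, he] using this
  rw [this, iid, Measure.infinitePi_pi _ fun i _ => hm i, Finset.prod_map]
  simp only [ht']

lemma integral_tilted_chainHam (ν : Measure ℝ) [IsProbabilityMeasure ν] {Φ : ℕ → ℝ → ℝ}
    {b₀ s : ℝ} (hΦ : IsInteraction Φ b₀ s) (M : ℕ) {F : (Fin M → ℝ) → ℝ} (hF : BddMeas F) :
    ∫ z, F z ∂((Measure.pi fun _ : Fin M => ν).tilted (chainHam Φ))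
      = ∫ ω, F (window M 0 ω) ∂(volGibbs ν Φ 0 M) := by
  have hw := measurable_window M 0
  have hH := bddMeas_chainHam hΦ M
  rw [volGibbs, integral_tilted_eq_div, integral_tilted_eq_div, ← map_window_iid ν M,
    integral_map hw.aemeasurable hH.exp.measurable.aestronglyMeasurable,
    integral_map hw.aemeasurable (hH.exp.mul hF).measurable.aestronglyMeasurable]
  simp only [ham_eq_chainHam]

variable {v : ℝ → EReal} {rhc zmin zmax α₁ α₂ s : ℝ}

/-- Nearest neighbours always interact because `1 ≤ m`, and no other term can be `⊥` and spoil the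
infinite one. -/
lemma IsLennardJonesType.energy_eq_top (hv : IsLennardJonesType v rhc zmin zmax α₁ α₂ s)
    {m : ℕ∞} (hm : 1 ≤ m) (p : ℝ) {M : ℕ} {z : Fin M → ℝ} (hz : ∀ i, 0 < z i) {i : Fin M}
    (hi : z i ≤ rhc) : energy v m p z = ⊤ := by
  have hterm : ∀ a b : Fin M, a ≤ b → (if ((Finset.Icc a b).card : ℕ∞) ≤ m
      then v (∑ l ∈ Finset.Icc a b, z l) else 0) ≠ ⊥ := fun a b hab => by
    split_ifs
    · refine hv.ne_bot_of_pos (Finset.sum_pos (fun l _ => hz l) ⟨a, ?_⟩)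
      simp [hab]
    · simp
  rw [energy, ereal_sum_eq_top Finset.univ (i := i) _ (Finset.mem_univ i), EReal.top_add_coe]
  · refine ereal_sum_eq_top _ (fun b hb => hterm i b (Finset.mem_Ici.1 hb)) (i := i) (by simp) ?_
    simp only [Finset.Icc_self, Finset.card_singleton, Finset.sum_singleton, Nat.cast_one, hm,
      if_true]
    exact hv.eq_top _ (hz i) hi
  · exact fun a _ => ereal_sum_ne_bot _ fun b hb => hterm a b (Finset.mem_Ici.1 hb)

/-- The diagonal pairs `i = j` go with the pressure into the single-site part. For the others the
cut-off `n * rhc < r` holds automatically, as each spacing exceeds `rhc`. -/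
lemma IsLennardJonesType.neg_mul_energy (hv : IsLennardJonesType v rhc zmin zmax α₁ α₂ s)
    {m : ℕ∞} (hm : 1 ≤ m) (p β : ℝ) {M : ℕ} {z : Fin M → ℝ} (hz : ∀ i, rhc < z i) :
    -((β : EReal) * energy v m p z) = ((∑ i, -(β * (realPart v (z i) + p * z i))
      + chainHam (chainInteraction v rhc m β) z : ℝ) : EReal) := by
  have hsum : ∀ a b : Fin M, a ≤ b →
      (((b : ℕ) + 1 - a : ℕ) : ℝ) * rhc < ∑ l ∈ Finset.Icc a b, z l := fun a b hab => by
    rw [← Fin.card_Icc, ← nsmul_eq_mul, ← Finset.sum_const]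
    exact Finset.sum_lt_sum_of_nonempty ⟨a, by simp [hab]⟩ fun l _ => hz l
  have hrhc : ∀ a b : Fin M, a ≤ b → rhc < ∑ l ∈ Finset.Icc a b, z l := fun a b hab => by
    have h0 := hv.rhc_nonneg
    have h1 : (1 : ℝ) ≤ (((b : ℕ) + 1 - a : ℕ) : ℝ) := by
      have : (a : ℕ) ≤ b := hab
      exact_mod_cast (by omega : 1 ≤ (b : ℕ) + 1 - a)
    refine lt_of_le_of_lt ?_ (hsum a b hab)
    nlinarith
  have h1 : energy v m p z = ((∑ i : Fin M, ∑ j ∈ Finset.Ici i,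
      (if ((Finset.Icc i j).card : ℕ∞) ≤ m then realPart v (∑ l ∈ Finset.Icc i j, z l) else 0)
      + p * ∑ i, z i : ℝ) : EReal) := by
    rw [energy, EReal.coe_add, ereal_coe_sum]
    congr 1
    refine Finset.sum_congr rfl fun i _ => ?_
    rw [ereal_coe_sum]
    refine Finset.sum_congr rfl fun j hj => ?_
    split_ifs
    · exact (hv.coe_realPart (hrhc i j (Finset.mem_Ici.1 hj))).symm
    · simp
  rw [h1, ← EReal.coe_mul, ← EReal.coe_neg, EReal.coe_eq_coe_iff]
  have h2 : ∀ i : Fin M, ∑ j : Fin M,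
      chainInteraction v rhc m β ((j : ℕ) + 1 - i) (∑ l ∈ Finset.Icc i j, z l)
      = -(β * ∑ j ∈ Finset.Ici i, (if ((Finset.Icc i j).card : ℕ∞) ≤ m
          then realPart v (∑ l ∈ Finset.Icc i j, z l) else 0)) + β * realPart v (z i) := by
    intro i
    have e1 : β * realPart v (z i) = ∑ j : Fin M, if i = j then β * realPart v (z i) else 0 := by
      simp
    have e2 : ∑ j ∈ Finset.Ici i, (if ((Finset.Icc i j).card : ℕ∞) ≤ m
          then realPart v (∑ l ∈ Finset.Icc i j, z l) else 0)
        = ∑ j : Fin M, if i ≤ j then (if ((Finset.Icc i j).card : ℕ∞) ≤ m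
          then realPart v (∑ l ∈ Finset.Icc i j, z l) else 0) else 0 := by
      rw [← Finset.sum_filter (s := Finset.univ) (p := fun j => i ≤ j)]
      congr 1
      ext j
      simp
    rw [e1, e2, Finset.mul_sum, ← Finset.sum_neg_distrib, ← Finset.sum_add_distrib]
    refine Finset.sum_congr rfl fun j _ => ?_
    rcases lt_trichotomy i j with h | h | h
    · have hlt : (i : ℕ) < j := h
      rw [if_pos h.le, if_neg h.ne, Fin.card_Icc, add_zero, chainInteraction]
      have c1 : 2 ≤ (j : ℕ) + 1 - i := by omega
      simp only [c1, hsum i j h.le, true_and, and_true]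
      split_ifs <;> simp
    · subst h
      simp [chainInteraction, hm]
    · have hlt : (j : ℕ) < i := h
      have c1 : ¬ 2 ≤ (j : ℕ) + 1 - i := by omega
      simp [chainInteraction, c1, not_le.2 h, h.ne']
  simp only [chainHam, h2, Finset.sum_add_distrib, Finset.sum_neg_distrib, ← Finset.mul_sum,
    mul_add]
  ring

lemma measurableSet_posOrthant (k : ℕ) : MeasurableSet (posOrthant k) := by
  have : posOrthant k = Set.pi univ fun _ => Ioi 0 := by ext z; simp [posOrthant, Set.mem_pi]
  rw [this]
  exact MeasurableSet.univ_pi fun _ => measurableSet_Ioi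

/-- Configurations violating the hard core have weight zero, so the orthant shrinks to `(rhc, ∞)^M`;
there the Boltzmann factor is a product density times the exponential of a bounded function. -/
lemma IsLennardJonesType.finiteGibbs_eq_tilted
    (hv : IsLennardJonesType v rhc zmin zmax α₁ α₂ s) {m : ℕ∞} (hm : 1 ≤ m) {p β b : ℝ}
    (hβ : 0 < β) (hp : 0 < p) (hΦ : IsInteraction (chainInteraction v rhc m β) b s) (M : ℕ) :
    finiteGibbs v m p β M = (Measure.pi fun _ : Fin M => siteMeasure v rhc β p).tilted
      (chainHam (chainInteraction v rhc m β)) := by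
  have hsite := hv.integrable_exp_site hβ hp
  have hprob : IsProbabilityMeasure ((volume.restrict (Ioi rhc)).tilted
    fun z => -(β * (realPart v z + p * z))) := hv.isProbabilityMeasure_siteMeasure hβ hp
  have hInt := integrable_exp_sum (volume.restrict (Ioi rhc)) hsite M
  unfold siteMeasure
  rw [pi_tilted, tilted_tilted hInt, ← inv_smul_withDensity_exp]
  swap
  · obtain ⟨C, hC⟩ := (bddMeas_chainHam hΦ M).exp.bdd
    simp only [Pi.add_apply, Real.exp_add]
    exact hInt.mul_bdd (c := C) (bddMeas_chainHam hΦ M).exp.measurable.aestronglyMeasurable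
      (ae_of_all _ fun z => by simpa using hC z)
  have key : gibbsWeight v m p β M =
      (Measure.pi fun _ : Fin M => volume.restrict (Ioi rhc)).withDensity
      fun z => ENNReal.ofReal (Real.exp (∑ i, -(β * (realPart v (z i) + p * z i))
        + chainHam (chainInteraction v rhc m β) z)) := by
    have hS : MeasurableSet (Set.pi univ fun _ : Fin M => Ioi rhc) :=
      MeasurableSet.univ_pi fun _ => measurableSet_Ioi
    have hsub : (Set.pi univ fun _ : Fin M => Ioi rhc) ⊆ posOrthant M := fun z hz i =>
      hv.rhc_nonneg.trans_lt (hz i (mem_univ i))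
    have hpos := measurableSet_posOrthant M
    rw [← Measure.restrict_pi_pi, ← volume_pi, ← inter_eq_left.2 hsub,
      ← Measure.restrict_restrict hS, ← withDensity_indicator hS, gibbsWeight]
    refine withDensity_congr_ae ((ae_restrict_iff' hpos).2 (ae_of_all _ fun z hz => ?_))
    by_cases hzS : z ∈ Set.pi univ fun _ : Fin M => Ioi rhc
    · dsimp only
      rw [indicator_of_mem hzS, hv.neg_mul_energy hm p β fun i => hzS i (mem_univ i),
        EReal.exp_coe]
    · rw [indicator_of_notMem hzS]
      simp only [Set.mem_pi, mem_univ, true_imp_iff, mem_Ioi, not_forall, not_lt] at hzS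
      obtain ⟨i, hi⟩ := hzS
      dsimp only
      rw [hv.energy_eq_top hm p hz hi, EReal.coe_mul_top_of_pos hβ, EReal.neg_top, EReal.exp_bot]
  rw [finiteGibbs, key]
  rfl

end

/-! ### Transfer of the estimates to the bulk measure. -/

section

section Limit

variable {ν : Measure ℝ} [IsProbabilityMeasure ν] {Φ : ℕ → ℝ → ℝ} {b₀ s : ℝ}
  {μ : Measure (ℤ → ℝ)}

lemma IsVolLimit.tendsto (hμ : IsVolLimit ν Φ μ) {k : ℕ} (a : ℤ) {h : (Fin k → ℝ) → ℝ}
    (hh : BddMeas h) {A B : ℕ → ℤ} (hA : Tendsto A atTop atBot) (hB : Tendsto B atTop atTop) :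
    Tendsto (fun N => ∫ ω, h (window k a ω) ∂(volGibbs ν Φ (A N) (B N))) atTop
      (𝓝 (∫ ω, h (window k a ω) ∂μ)) := by
  obtain ⟨M, hM⟩ := hh.bdd
  have hM0 : 0 ≤ M := (abs_nonneg _).trans (hM 0)
  have hM1 : 0 < M + 1 := by linarith
  rw [Metric.tendsto_atTop']
  intro ε hε
  obtain ⟨R, hR⟩ := hμ (ε / (2 * (M + 1))) (by positivity)
  obtain ⟨N₀, hN₀⟩ := eventually_atTop.1
    ((hA.eventually_le_atBot (a - R)).and (hB.eventually_ge_atTop (a + k + R)))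
  refine ⟨N₀, fun N hN => ?_⟩
  have hAB := hN₀ N hN.le
  -- Rescaling to a function bounded by `1`; `M + 1` avoids division by zero.
  have key := hR k a (fun x => h x * (M + 1)⁻¹) (hh.mul (BddMeas.const _)) (fun x => by
    rw [abs_mul, abs_of_pos (inv_pos.2 hM1), ← div_eq_mul_inv, div_le_one hM1]
    linarith [hM x]) (A N) (B N) hAB.1 hAB.2
  rw [integral_mul_const, integral_mul_const, ← sub_mul, abs_mul, abs_of_pos (inv_pos.2 hM1),
    ← div_eq_mul_inv, div_le_iff₀ hM1] at key
  rw [Real.dist_eq]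
  refine key.trans_lt ?_
  have : ε / (2 * (M + 1)) * (M + 1) = ε / 2 := by field_simp
  rw [this]
  linarith

lemma tendsto_natCast_int : Tendsto (fun N : ℕ => (N : ℤ)) atTop atTop :=
  tendsto_natCast_atTop_atTop

lemma tendsto_neg_natCast_int : Tendsto (fun N : ℕ => -(N : ℤ)) atTop atBot :=
  tendsto_neg_atTop_atBot.comp tendsto_natCast_int

/-- The single-site domination gives nonpositive values probability zero in every volume.
Convergence on measurable local functions lets this pass to the limit, although the set is not open.
-/
lemma IsVolLimit.ae_pos (hμ : IsVolLimit ν Φ μ) [IsProbabilityMeasure μ]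
    (hΦ : IsInteraction Φ b₀ s) {K : ℝ} (hK : CrossBound Φ K) (hν : ∀ᵐ z ∂ν, 0 < z) :
    ∀ᵐ ω ∂μ, ∀ j, 0 < ω j := by
  rw [ae_all_iff]
  intro j
  have hS : MeasurableSet {x : Fin 1 → ℝ | x 0 ∈ Iic (0 : ℝ)} := measurable_pi_apply 0 measurableSet_Iic
  have hi : BddMeas ({x : Fin 1 → ℝ | x 0 ∈ Iic (0 : ℝ)}.indicator fun _ => (1 : ℝ)) :=
    BddMeas.indicator hS
  have hset : ∀ P : Measure (ℤ → ℝ),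
      ∫ ω, {x : Fin 1 → ℝ | x 0 ∈ Iic (0 : ℝ)}.indicator (fun _ => (1 : ℝ)) (window 1 j ω) ∂P
        = P.real {ω | ω j ∈ Iic (0 : ℝ)} := fun P => by
    have hm : MeasurableSet {ω : ℤ → ℝ | ω j ∈ Iic (0 : ℝ)} :=
      measurable_pi_apply j measurableSet_Iic
    rw [← integral_indicator_one hm]
    congr 1 with ω
    simp [indicator, window]
  have ht := hμ.tendsto j hi tendsto_neg_natCast_int tendsto_natCast_int
  simp only [hset] at ht
  have h0 : ∀ A B, (volGibbs ν Φ A B).real {ω | ω j ∈ Iic (0 : ℝ)} = 0 := fun A B => by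
    have hν0 : ν (Iic 0) = 0 := by
      have := ae_iff.1 hν
      simpa [Iic] using this
    have := volGibbs_site_le ν hΦ hK A B j (measurableSet_Iic (a := (0 : ℝ)))
    rw [hν0, mul_zero, nonpos_iff_eq_zero] at this
    rw [Measure.real, this, ENNReal.toReal_zero]
  simp only [h0] at ht
  have := tendsto_nhds_unique ht tendsto_const_nhds
  rw [ae_iff]
  rw [measureReal_eq_zero_iff] at this
  simpa using this

/-- The covariance as a limit of covariances in finite volume. -/
lemma IsVolLimit.abs_correlation_le (hμ : IsVolLimit ν Φ μ) (hΦ : IsInteraction Φ b₀ s)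
    {K κ : ℝ} {L : ℕ} (hK : CrossBound Φ K) (hκ : FarBound Φ L κ) {k n q : ℕ}
    (hn : k + q * L ≤ n) {f g : (Fin k → ℝ) → ℝ} (hf : BddMeas f) (hg : BddMeas g) {F G : ℝ}
    (hF : ∀ x, |f x| ≤ F) (hG : ∀ x, |g x| ≤ G) :
    |correlation μ f g n| ≤ oscRate K κ q * F * G := by
  have h1 := hμ.tendsto 0 hf tendsto_neg_natCast_int tendsto_natCast_int
  have h2 := hμ.tendsto (n : ℤ) hg tendsto_neg_natCast_int tendsto_natCast_int
  -- The product of both observables is a single local function of a window of length `n + k`.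
  let π₁ : (Fin (n + k) → ℝ) → Fin k → ℝ := fun x l => x ⟨l, by omega⟩
  let π₂ : (Fin (n + k) → ℝ) → Fin k → ℝ := fun x l => x ⟨n + l, by omega⟩
  have hπ₁ : Measurable π₁ := measurable_pi_lambda _ fun l => measurable_pi_apply _
  have hπ₂ : Measurable π₂ := measurable_pi_lambda _ fun l => measurable_pi_apply _
  have h3 := hμ.tendsto 0 ((hf.comp hπ₁).mul (hg.comp hπ₂))
    tendsto_neg_natCast_int tendsto_natCast_int
  have e1 : ∀ ω, π₁ (window (n + k) 0 ω) = window k 0 ω := fun ω => by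
    ext l; simp [π₁, window]
  have e2 : ∀ ω, π₂ (window (n + k) 0 ω) = window k n ω := fun ω => by
    ext l; simp [π₂, window]
  simp only [e1, e2] at h3
  refine le_of_tendsto (h3.sub (h1.mul h2)).abs ?_
  filter_upwards [eventually_ge_atTop n] with N hN
  have hq : ((n : ℤ) - q * L) + q * L = n := by ring
  have hn' : (k : ℤ) + q * L ≤ n := by exact_mod_cast hn
  -- The `q` blocks are placed to end at `n`, where the window of `g` starts.
  refine abs_cov_tilted_ham_le ν hΦ hK hκ (A := -N) (B := N) (b := (n : ℤ) - q * L) q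
    (by omega) (by rw [hq]; exact_mod_cast hN) (hf.comp (measurable_window k 0))
    (hg.comp (measurable_window k n)) (fun x y hxy => ?_) (fun x y hxy => ?_)
    (fun x => hF _) (fun x => hG _)
  · dsimp only
    rw [window_eqOn fun i hi => hxy i ?_]
    simp only [mem_Ico, mem_Iio] at *
    omega
  · rw [hq] at hxy
    dsimp only
    rw [window_eqOn fun i hi => hxy i ?_]
    exact hi.1

end Limit

/-! ### The bulk Gibbs measure -/

lemma measurable_finWindow (M k i : ℕ) : Measurable (finWindow k i : (Fin M → ℝ) → Fin k → ℝ) := by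
  refine measurable_pi_lambda _ fun l => ?_
  by_cases h : i + (l : ℕ) < M
  · simp only [finWindow, h, dite_true]
    exact measurable_pi_apply _
  · simp only [finWindow, h, dite_false]
    exact measurable_const

lemma finWindow_window {M k i : ℕ} (h : i + k ≤ M) (ω : ℤ → ℝ) :
    finWindow k i (window M 0 ω) = window k i ω := by
  ext l
  have : i + (l : ℕ) < M := by omega
  simp [finWindow, window, this]

/-- Viewing the chain from its midpoint determines the laws of all windows, hence all
finite-dimensional marginals and the measure. -/
lemma IsBulkGibbsMeasure.unique {v : ℝ → EReal} {m : ℕ∞} {p β : ℝ} {μ μ' : Measure (ℤ → ℝ)}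
    (h : IsBulkGibbsMeasure v m p β μ) (h' : IsBulkGibbsMeasure v m p β μ') : μ = μ' := by
  have i1 := h.isProbabilityMeasure
  have i2 := h'.isProbabilityMeasure
  have hi1 : Tendsto (fun M : ℕ => M / 2) atTop atTop :=
    Nat.tendsto_div_const_atTop (by norm_num)
  have hi2 : Tendsto (fun M : ℕ => (M : ℤ) - ((M / 2 : ℕ) : ℤ)) atTop atTop := by
    refine tendsto_atTop_mono (fun M => ?_) (tendsto_natCast_int.comp hi1)
    simp only [Function.comp_apply]
    omega
  have hwin : ∀ (k : ℕ) (a : ℤ), μ.map (window k a) = μ'.map (window k a) := fun k a => by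
    have hw := measurable_window k a
    have := Measure.isProbabilityMeasure_map (μ := μ) hw.aemeasurable
    have := Measure.isProbabilityMeasure_map (μ := μ') hw.aemeasurable
    refine ext_of_forall_integral_eq_of_IsFiniteMeasure fun f => ?_
    rw [integral_map hw.aemeasurable f.continuous.measurable.aestronglyMeasurable,
      integral_map hw.aemeasurable f.continuous.measurable.aestronglyMeasurable]
    exact tendsto_nhds_unique (h.tendsto k f a _ hi1 hi2) (h'.tendsto k f a _ hi1 hi2)
  have hproj : ∀ I : Finset ℤ, μ.map I.restrict = μ'.map I.restrict := fun I => by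
    set N : ℕ := I.sup Int.natAbs + 1 with hN
    have hI : ∀ i ∈ I, i.natAbs < N := fun i hi => Nat.lt_succ_of_le (Finset.le_sup hi)
    let π : (Fin (2 * N) → ℝ) → (I → ℝ) := fun x i =>
      x ⟨((i : ℤ) + N).toNat, by have := hI i i.2; omega⟩
    have hπ : Measurable π := measurable_pi_lambda _ fun i => measurable_pi_apply _
    have e : (I.restrict : (ℤ → ℝ) → I → ℝ) = π ∘ window (2 * N) (-N) := by
      ext ω i
      have := hI i i.2
      simp only [Finset.restrict, Function.comp_apply, π, window]
      congr 1
      omega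
    rw [e, ← Measure.map_map hπ (measurable_window _ _), hwin,
      Measure.map_map hπ (measurable_window _ _)]
  have hfin : ∀ I : Finset ℤ, IsFiniteMeasure (μ'.map (I.restrict : (ℤ → ℝ) → I → ℝ)) :=
    fun I => inferInstance
  exact IsProjectiveLimit.unique (P := fun I : Finset ℤ => μ'.map I.restrict) hproj fun I => rfl

variable {v : ℝ → EReal} {rhc zmin zmax α₁ α₂ s : ℝ}

/-- Shifting the site `i M` to `a` turns the chain into the volume `[a - i M, M + a - i M)`, which
exhausts `ℤ`. -/
lemma IsLennardJonesType.isBulkGibbsMeasure (hv : IsLennardJonesType v rhc zmin zmax α₁ α₂ s)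
    {m : ℕ∞} (hm : 1 ≤ m) {p β b : ℝ} (hβ : 0 < β) (hp : 0 < p)
    [IsProbabilityMeasure (siteMeasure v rhc β p)]
    (hΦ : IsInteraction (chainInteraction v rhc m β) b s)
    {K : ℝ} (hK : CrossBound (chainInteraction v rhc m β) K)
    {μ : Measure (ℤ → ℝ)} [hμp : IsProbabilityMeasure μ]
    (hμ : IsVolLimit (siteMeasure v rhc β p) (chainInteraction v rhc m β) μ) :
    IsBulkGibbsMeasure v m p β μ where
  isProbabilityMeasure := hμp
  ae_pos := hμ.ae_pos hΦ hK
    ((siteMeasure_ae v rhc β p).mono fun _ hz => hv.rhc_nonneg.trans_lt hz)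
  tendsto k f a i hi hMi := by
    have hfb : BddMeas f := ⟨f.continuous.measurable, ‖f‖, fun x => f.norm_coe_le_norm x⟩
    have hA : Tendsto (fun M : ℕ => a - (i M : ℤ)) atTop atBot :=
      tendsto_const_nhds.add_atBot (tendsto_neg_atTop_atBot.comp (tendsto_natCast_int.comp hi))
    have hB : Tendsto (fun M : ℕ => (M : ℤ) + (a - (i M : ℤ))) atTop atTop := by
      have := tendsto_atTop_add_const_right atTop a hMi
      refine this.congr fun M => ?_
      ring
    refine (hμ.tendsto a hfb hA hB).congr' ?_
    filter_upwards [hMi.eventually_ge_atTop k] with M hM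
    have hle : i M + k ≤ M := by omega
    rw [hv.finiteGibbs_eq_tilted hm hβ hp hΦ, integral_tilted_chainHam _ hΦ M
      (hfb.comp (measurable_finWindow M k (i M)))]
    simp only [finWindow_window hle]
    have := integral_volGibbs_shift (siteMeasure v rhc β p) hΦ 0 M (a - i M)
      (hfb.comp (measurable_window k (i M)))
    rw [← this, zero_add]
    congr 1 with ω
    congr 1
    ext l
    simp only [window]
    congr 1
    ring

/-! ### Functions on the orthant -/

lemma supNorm_nonneg {k : ℕ} (f : (Fin k → ℝ) → ℝ) : 0 ≤ supNorm f :=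
  Real.iSup_nonneg fun _ => abs_nonneg _

lemma abs_indicator_le_supNorm {k : ℕ} {f : (Fin k → ℝ) → ℝ} (hf : IsBoundedFun f)
    (x : Fin k → ℝ) : |(posOrthant k).indicator f x| ≤ supNorm f := by
  by_cases hx : x ∈ posOrthant k
  · rw [indicator_of_mem hx]
    exact le_ciSup hf (⟨x, hx⟩ : posOrthant k)
  · rw [indicator_of_notMem hx, abs_zero]
    exact supNorm_nonneg f

lemma bddMeas_indicator_posOrthant {k : ℕ} {f : (Fin k → ℝ) → ℝ} (hfm : Measurable f)
    (hf : IsBoundedFun f) : BddMeas ((posOrthant k).indicator f) :=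
  ⟨hfm.indicator (measurableSet_posOrthant k), _, abs_indicator_le_supNorm hf⟩

/-- The test functions are bounded only on the orthant, which carries the law of every window;
cutting them off makes them bounded everywhere. -/
lemma correlation_indicator {μ : Measure (ℤ → ℝ)} (hpos : ∀ᵐ z ∂μ, ∀ j, 0 < z j) {k : ℕ}
    (f g : (Fin k → ℝ) → ℝ) (n : ℕ) :
    correlation μ f g n
      = correlation μ ((posOrthant k).indicator f) ((posOrthant k).indicator g) n := by
  have hw : ∀ᵐ z ∂μ, ∀ a : ℤ, window k a z ∈ posOrthant k :=
    hpos.mono fun z hz a l => hz _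
  unfold correlation
  congr 1
  · refine integral_congr_ae (hw.mono fun z hz => ?_)
    simp only [indicator_of_mem (hz _)]
  · congr 1
    · refine integral_congr_ae (hw.mono fun z hz => ?_)
      simp only [indicator_of_mem (hz _)]
    · refine integral_congr_ae (hw.mono fun z hz => ?_)
      simp only [indicator_of_mem (hz _)]

lemma abs_correlation_le_mul {μ : Measure (ℤ → ℝ)} [IsProbabilityMeasure μ] {k : ℕ}
    {f g : (Fin k → ℝ) → ℝ} (hf : BddMeas f) (hg : BddMeas g) {F G : ℝ}
    (hF : ∀ x, |f x| ≤ F) (hG : ∀ x, |g x| ≤ G) (n : ℕ) :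
    |correlation μ f g n| ≤ F * G :=
  abs_cov_le_of_osc μ (hf.comp (measurable_window k 0)) (hg.comp (measurable_window k n))
    (fun x y => (abs_sub _ _).trans
      (by linarith [hF (window k 0 x), hF (window k 0 y)])) fun x => hG _

/-! ### The rate -/

/-- Rounding down `n / q ≥ 1` loses at most a factor `2`, whence `2 ^ (s - 2)`. -/
lemma rpow_div_le {s : ℝ} (hs : 2 < s) {n q : ℕ} (hq : 1 ≤ q) (hqn : q ≤ n) :
    ((n / q : ℕ) : ℝ) ^ (2 - s) ≤ 2 ^ (s - 2) * ((q : ℝ) / n) ^ (s - 2) := by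
  have hL : 1 ≤ n / q := (Nat.one_le_div_iff hq).2 hqn
  have hq0 : (0 : ℝ) < q := by exact_mod_cast hq
  have hn0 : (0 : ℝ) < n := by exact_mod_cast (hq.trans hqn)
  have h1 : (n : ℝ) / (2 * q) ≤ ((n / q : ℕ) : ℝ) := by
    rw [div_le_iff₀ (by positivity)]
    have h2 : n < q * (n / q + 1) := Nat.lt_mul_div_succ n hq
    have h3 : n ≤ n / q * (2 * q) := by nlinarith
    exact_mod_cast h3
  calc ((n / q : ℕ) : ℝ) ^ (2 - s) ≤ ((n : ℝ) / (2 * q)) ^ (2 - s) :=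
        Real.rpow_le_rpow_of_nonpos (by positivity) h1 (by linarith)
    _ = (2 * ((q : ℝ) / n)) ^ (s - 2) := by
        rw [show 2 - s = -(s - 2) by ring, Real.rpow_neg (by positivity),
          ← Real.inv_rpow (by positivity)]
        congr 1
        field_simp
    _ = _ := Real.mul_rpow (by norm_num) (by positivity)

lemma one_sub_exp_neg_le {x y : ℝ} (hxy : x ≤ y) : 1 - Real.exp (-x) ≤ Real.exp y - 1 := by
  have h1 := Real.add_one_le_exp (-x)
  have h2 := Real.add_one_le_exp y
  linarith

end

end LJChain

end

theorem mainTheorem7 (v : ℝ → EReal) (rhc zmin zmax α₁ α₂ s : ℝ)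
    (hv : LJChain.IsLennardJonesType v rhc zmin zmax α₁ α₂ s) (hrhc : 0 < rhc)
    (m : ℕ∞) (hm : 1 ≤ m) :
    ∃ c C : ℝ, 0 < c ∧ 0 < C ∧ ∀ β p : ℝ, 0 < β → 0 < p →
      (∃! μ : MeasureTheory.Measure (ℤ → ℝ), LJChain.IsBulkGibbsMeasure v m p β μ) ∧
      ∀ μ : MeasureTheory.Measure (ℤ → ℝ), LJChain.IsBulkGibbsMeasure v m p β μ →
        ∀ (k : ℕ), 1 ≤ k → ∀ f g : (Fin k → ℝ) → ℝ, Measurable f → Measurable g →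
          LJChain.IsBoundedFun f → LJChain.IsBoundedFun g → ∀ n : ℕ,
            (∀ q : ℕ, 1 ≤ q → (q : ℝ) ≤ (n : ℝ) / (k : ℝ) →
              |LJChain.correlation μ f g n| ≤
                ((1 - Real.exp (-(c * β))) ^ q
                  + Real.exp (c * β) *
                    (Real.exp (C * β * ((q : ℝ) / (n : ℝ)) ^ (s - 2)) - 1))
                * LJChain.supNorm f * LJChain.supNorm g) ∧
            (m = ((k + 1 : ℕ) : ℕ∞) →
              |LJChain.correlation μ f g n| ≤
                (1 - Real.exp (-(c * β))) ^ ⌊(n : ℝ) / (k : ℝ)⌋₊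
                * LJChain.supNorm f * LJChain.supNorm g) := by
  have hs := hv.two_lt_s
  obtain ⟨b, hb0, hb⟩ := hv.exists_abs_realPart_le hrhc
  have hdec := LJChain.decayConst_pos hs
  -- The first constant satisfies `c * β = 4K`; the second is that of `4κ` times the rounding loss
  -- for blocks of length `⌊n/q⌋`.
  refine ⟨4 * (b * (2 ^ s * LJChain.decayConst s)),
    4 * (b * LJChain.decayConst s) * 2 ^ (s - 2), by positivity, by positivity,
    fun β p hβ hp => ?_⟩
  have hprob := hv.isProbabilityMeasure_siteMeasure hβ hp
  have hΦ := hv.isInteraction hrhc m hβ hb0 hb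
  have hβb : 0 ≤ β * b := by positivity
  have hK := LJChain.crossBound hΦ hβb hs
  obtain ⟨μ₀, hμ₀p, hμ₀⟩ := LJChain.exists_bulk (LJChain.siteMeasure v rhc β p) hΦ hβb hs
  have hbulk := hv.isBulkGibbsMeasure hm hβ hp hΦ hK (μ := μ₀) hμ₀
  refine ⟨⟨μ₀, hbulk, fun μ hμ => hμ.unique hbulk⟩, fun μ hμ k hk f g hfm hgm hf hg n => ?_⟩
  obtain rfl := hμ.unique hbulk
  have hf' := LJChain.bddMeas_indicator_posOrthant hfm hf
  have hg' := LJChain.bddMeas_indicator_posOrthant hgm hg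
  have hF := LJChain.abs_indicator_le_supNorm hf
  have hG := LJChain.abs_indicator_le_supNorm hg
  have hF0 := LJChain.supNorm_nonneg f
  have hG0 := LJChain.supNorm_nonneg g
  have hk0 : (0 : ℝ) < k := by exact_mod_cast hk
  have hc : 4 * (b * (2 ^ s * LJChain.decayConst s)) * β
      = 4 * (β * b * (2 ^ s * LJChain.decayConst s)) := by ring
  rw [LJChain.correlation_indicator hμ.ae_pos, hc]
  refine ⟨fun q hq hqn => ?_, fun hmk => ?_⟩
  · have hqk : q * k ≤ n := by
      rw [le_div_iff₀ hk0] at hqn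
      exact_mod_cast hqn
    have hqn' : q ≤ n := (Nat.le_mul_of_pos_right q hk).trans hqk
    have hkL : k ≤ n / q := (Nat.le_div_iff_mul_le hq).2 (by linarith)
    have hL := LJChain.farBound hΦ hβb hs (hk.trans hkL)
    -- Only `q - 1` separating blocks fit, as the window of `f` takes up to one block length; the
    -- initial cut in `oscRate` restores the exponent `q`.
    have hn : k + (q - 1) * (n / q) ≤ n := by
      have h1 : n / q * q ≤ n := Nat.div_mul_le_self n q
      obtain ⟨q, rfl⟩ : ∃ r, q = r + 1 := ⟨q - 1, by omega⟩
      simp only [Nat.add_sub_cancel]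
      nlinarith
    refine (hμ₀.abs_correlation_le hΦ hK hL hn hf' hg' hF hG).trans ?_
    refine mul_le_mul_of_nonneg_right (mul_le_mul_of_nonneg_right ?_ hF0) hG0
    refine (LJChain.oscRate_le hK.nonneg hL.nonneg _).trans ?_
    rw [Nat.sub_add_cancel hq]
    have hκ : 4 * (β * b * LJChain.decayConst s * ((n / q : ℕ) : ℝ) ^ (2 - s))
        ≤ 4 * (b * LJChain.decayConst s) * 2 ^ (s - 2) * β * ((q : ℝ) / n) ^ (s - 2) := by
      have h0 : 0 ≤ 4 * (β * b * LJChain.decayConst s) := by positivity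
      have := mul_le_mul_of_nonneg_left (LJChain.rpow_div_le hs hq hqn') h0
      linarith
    exact add_le_add le_rfl (mul_le_mul_of_nonneg_left (LJChain.one_sub_exp_neg_le hκ)
      (Real.exp_pos _).le)
  · rw [Nat.floor_div_eq_div]
    rcases lt_or_ge n k with hnk | hnk
    -- The windows may overlap here, but the exponent is `0` and the trivial covariance bound
    -- suffices.
    · rw [Nat.div_eq_of_lt hnk, pow_zero, one_mul]
      have := hμ.isProbabilityMeasure
      exact LJChain.abs_correlation_le_mul hf' hg' hF hG n
    -- Crossing `k = m - 1` spacings involves at least `m + 1` of them, beyond the range.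
    · have hfar : LJChain.FarBound (LJChain.chainInteraction v rhc m β) k 0 :=
        LJChain.farBound_zero fun j r hj => by
          rw [LJChain.chainInteraction, if_neg]
          rintro ⟨-, hjm, -⟩
          rw [hmk, Nat.cast_le] at hjm
          omega
      have hq : 1 ≤ n / k := (Nat.one_le_div_iff hk).2 hnk
      have hn : k + (n / k - 1) * k ≤ n := by
        have h1 : n / k * k ≤ n := Nat.div_mul_le_self n k
        obtain ⟨q, hq'⟩ : ∃ r, n / k = r + 1 := ⟨n / k - 1, by omega⟩
        rw [hq'] at h1 ⊢
        simp only [Nat.add_sub_cancel]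
        nlinarith
      have := hμ₀.abs_correlation_le hΦ hK hfar hn hf' hg' hF hG
      rwa [LJChain.oscRate_zero_right, Nat.sub_add_cancel hq] at this
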